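/- \textbf{Setting.} Let $T=(V,E)$ be a tree with $N$ vertices (parties) and a fixed root $v_1\in V$. Let $\mathcal H=\mathbb C^D$ with $D\ge 1$, let $\tilde{\mathcal H}^{v}$ ($v\in V$) be finite-dimensional Hilbert spaces, let $U:\mathcal H\to\bigotimes_{v\in V}\tilde{\mathcal H}^{v}$ be an isometry, and let $M_e\ge 1$ ($e\in E$) be integers. Write $|\Phi_M^+\rangle=\frac1{\sqrt M}\sum_{l=0}^{M-1}|l\rangle\otimes|l\rangle$. \emph{Concentrating quantum information over $T$ for $U$ is achievable} (with $(M_e)_{e\in E}$) if there is a finite-round LOCC map $\mathcal C$ of the parties $V$, where for each edge $e$ the two end vertices share $|\Phi_{M_e}^+\rangle$, with $$\mathcal C\Big(U\rho U^\dagger\otimes\bigotimes_{e\in E}|\Phi_{M_e}^+\rangle\langle\Phi_{M_e}^+|\Big)=\rho\quad\text{at }v_1,\text{ for all density operators }\rho\text{ on }\mathcal H .$$ An \emph{ascending labeling} is a numbering $v_1,\dots,v_N$ of $V$, starting with the root, in which every vertex on the path from $v_1$ to $v_k$ has a label at most $k$; $p(v_k)$ denotes the parent of $v_k$. \textbf{Koashi--Imoto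 decompositions and merging.} A Koashi--Imoto decomposition of a unit vector $\psi\in\mathcal H^{R}\otimes\mathcal H^{A}\otimes\mathcal H^{B}$ consists of decompositions $\bigoplus_{j}\mathcal H^{a_j^L}\otimes\mathcal H^{a_j^R}$ and $\bigoplus_{j}\mathcal H^{b_j^L}\otimes\mathcal H^{b_j^R}$ of $\mathcal H^A$ and $\mathcal H^B$ (or of subspaces of them that contain the supports of the reduced states of $\psi$), a probability distribution $p$, and unit vectors $\omega_j\in\mathcal H^{a_j^L}\otimes\mathcal H^{b_j^L}$, $\phi_j\in\mathcal H^{R}\otimes\mathcal H^{a_j^R}\otimes\mathcal H^{b_j^R}$ with $\psi=\bigoplus_j\sqrt{p(j)}\,\omega_j\otimes\phi_j$. Let $\lambda_0^{a_j^L}$ be the largest eigenvalue of the reduced state of $\omega_j$ on $\mathcal H^{a_j^L}$. A measurement $\{|m\rangle\}$ of $A$, with $\sum_m|m\rangle\langle m|=1$ on $\mathcal H^A$ and $A$'s half of $\Phi_K^+$, achieves exact state merging of $\psi$ with $\Phi_K^+$ if for each outcome $m$ an isometry of $B$ takes $(1\otimes\langle m|)(\psi\otimes\Phi_K^+)$ to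 $\psi\otimes\chi_m$, where $A$'s part of $\psi$ is now at $B$ and $\chi_m$ is some vector of an auxiliary system of $B$. \textbf{Intermediate states.} Given an ascending labeling, put $|\Phi^N\rangle=\frac1{\sqrt D}\sum_{l}|l\rangle\otimes U|l\rangle\in\mathcal H^R\otimes\bigotimes_v\tilde{\mathcal H}^{v}$ with $\mathcal H^R=\mathbb C^D$. For $k=N,N-1,\dots,2$, given the state $\Phi^{k}_{\boldsymbol m_k}$ of $R,v_1,\dots,v_k$, where $\boldsymbol m_k$ are the outcomes of $v_N,\dots,v_{k+1}$, take $R$, $v_k$ and $v_1\cdots v_{k-1}$ in the roles of $R$, $A$, $B$ and $e=\{p(v_k),v_k\}$. Fix a Koashi--Imoto decomposition of $\Phi^k_{\boldsymbol m_k}$, with blocks $\mathcal H_{\boldsymbol m_k}^{(v_k)_j^L}\otimes\mathcal H_{\boldsymbol m_k}^{(v_k)_j^R}$ on the side of $v_k$ and eigenvalues $\lambda_{\boldsymbol m_k,0}^{(v_k)_j^L}$. Let $v_k$ perform a measurement $\{|m^{v_k}\rangle\}$ that achieves exact state merging of $\Phi^k_{\boldsymbol m_k}$ with $\Phi_{M_e}^+$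 (if one exists; otherwise any family of vectors), and for each outcome of non-zero probability let $\Phi^{k-1}_{\boldsymbol m_{k-1}}$ be the normalisation of $(1\otimes\langle m^{v_k}|)(\Phi^k_{\boldsymbol m_k}\otimes\Phi_{M_e}^+)$, with the remaining half of $\Phi_{M_e}^+$ counted as part of the system of $p(v_k)$. \textbf{Theorem.} For every tree $T$ and isometry $U$, concentrating quantum information over $T$ for $U$ is achievable if there is an ascending labeling of the vertices, with some choice of the decompositions and measurements above, such that for each edge $e=\{p(v_k),v_k\}\in E$ $$\log_2 M_e\;\ge\;\max_{\boldsymbol m_k,\,j}\ \log_2\Big\lceil\lambda_{\boldsymbol m_k,0}^{(v_k)_j^L}\,\dim\mathcal H_{\boldsymbol m_k}^{(v_k)_j^R}\Big\rceil .$$ -/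

import Mathlib

open scoped Matrix ComplexOrder

noncomputable section

/-! ### LOCC maps

A system of the parties `v : V` has local spaces `ℂ^(ι v)` with `ι v` finite; an operator on the
joint system is a matrix indexed by `∀ v, ι v`. -/

/-- The tensor product `⨂ v, A v` of local operators `A v : ℂ^(ι v) → ℂ^(κ v)`. -/
def localOp {V : Type} [Fintype V] {ι κ : V → Type} (A : ∀ v, Matrix (κ v) (ι v) ℂ) :
    Matrix (∀ v, κ v) (∀ v, ι v) ℂ :=
  fun y x => ∏ v, A v (y v) (x v)

/-- Deterministic LOCC maps with finitely many rounds.  In each round one party `v` performs a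
measurement with Kraus operators `A o v` (`o` the outcome, `∑ o, (A o v)ᴴ * A o v = 1`) and
announces `o` to everybody; every other party `w` then applies a local isometry `A o w` depending
on `o` (for instance the identity), and the protocol goes on with an LOCC map depending on `o`.
All local dimensions may change and may depend on the outcomes.  A local channel or instrument of
a party is a measurement round whose outcome (or a part of it) is not used afterwards. -/
inductive IsLOCC {V : Type} [Fintype V] [DecidableEq V] {κ : V → Type} :
    {ι : V → Type} →
    (Matrix (∀ v, ι v) (∀ v, ι v) ℂ → Matrix (∀ v, κ v) (∀ v, κ v) ℂ) → Prop
  | id : IsLOCC (ι := κ) (fun ρ => ρ)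
  | round {ι : V → Type} [∀ v, Fintype (ι v)] [∀ v, DecidableEq (ι v)]
      (v : V) {O : Type} [Fintype O] {ι' : O → V → Type} [∀ o w, Fintype (ι' o w)]
      (A : ∀ o w, Matrix (ι' o w) (ι w) ℂ)
      (hv : ∑ o, (A o v)ᴴ * A o v = 1)
      (hw : ∀ o w, w ≠ v → (A o w)ᴴ * A o w = 1)
      (next : ∀ o, Matrix (∀ w, ι' o w) (∀ w, ι' o w) ℂ → Matrix (∀ w, κ w) (∀ w, κ w) ℂ)
      (hnext : ∀ o, IsLOCC (next o)) :
      IsLOCC (ι := ι) (fun ρ => ∑ o, next o (localOp (A o) * ρ * (localOp (A o))ᴴ))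

/-! ### Concentrating quantum information over a graph -/

/-- Amplitude `⟨i j | Φ_M⁺⟩` of the maximally entangled state `M^(-1/2) ∑ l, |l⟩ ⊗ |l⟩`. -/
def maxEnt (M : ℕ) (i j : Fin M) : ℂ :=
  if i = j then ((1 / Real.sqrt M : ℝ) : ℂ) else 0

section Task

variable {V : Type} [Fintype V] [DecidableEq V]

/-- Basis labels of everything party `v` holds at the beginning of the task: its part `ℂ^(ι v)`
of the physical system and, for each edge `e` at `v`, its half of `Φ_{M e}⁺`. -/
abbrev InitialSystem (G : SimpleGraph V) (M : Sym2 V → ℕ) (ι : V → Type) (v : V) : Type :=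
  ι v × (∀ e : G.edgeSet, v ∈ e.1 → Fin (M e.1))

/-- Basis labels of what party `v` holds at the end: the logical system `ℂ^D` if `v` is the party
`r`, and a one-dimensional system otherwise. -/
abbrev FinalSystem (r : V) (D : ℕ) (v : V) : Type := v = r → Fin D

open Classical in
/-- Amplitude of the initial resource state `⨂ e, |Φ_{M e}⁺⟩`: the product over the edges of
`1 / √(M e)` if both halves carry the same label, and of `0` otherwise. -/
def resourceAmp (G : SimpleGraph V) [DecidableRel G.Adj] (M : Sym2 V → ℕ) {ι : V → Type}
    (x : ∀ v, InitialSystem G M ι v) : ℂ :=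
  ∏ e : G.edgeSet,
    if ∀ v w, ∀ (hv : v ∈ e.1) (hw : w ∈ e.1), (x v).2 e hv = (x w).2 e hw
    then ((1 / Real.sqrt (M e.1) : ℝ) : ℂ) else 0

/-- The initial state `U ρ U† ⊗ ⨂ e, |Φ_{M e}⁺⟩⟨Φ_{M e}⁺|`. -/
def initialState (G : SimpleGraph V) [DecidableRel G.Adj] (M : Sym2 V → ℕ) {ι : V → Type}
    {D : ℕ} (U : Matrix (∀ v, ι v) (Fin D) ℂ) (ρ : Matrix (Fin D) (Fin D) ℂ) :
    Matrix (∀ v, InitialSystem G M ι v) (∀ v, InitialSystem G M ι v) ℂ :=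
  fun x y => (U * ρ * Uᴴ) (fun v => (x v).1) (fun v => (y v).1) *
    (resourceAmp G M x * star (resourceAmp G M y))

/-- The state `ρ` located at party `r`. -/
def finalState (r : V) {D : ℕ} (ρ : Matrix (Fin D) (Fin D) ℂ) :
    Matrix (∀ v, FinalSystem r D v) (∀ v, FinalSystem r D v) ℂ :=
  fun x y => ρ (x r rfl) (y r rfl)

/-- Concentrating quantum information over `G` for `U` is achievable with the initial resource
state given by `M`: a single LOCC map recovers at `r` every density operator `ρ` from `U ρ U†`,
exactly and deterministically. -/
def ConcentratingAchievable (G : SimpleGraph V) [DecidableRel G.Adj] (r : V) {ι : V → Type}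
    {D : ℕ} (U : Matrix (∀ v, ι v) (Fin D) ℂ) (M : Sym2 V → ℕ) : Prop :=
  ∃ C : Matrix (∀ v, InitialSystem G M ι v) (∀ v, InitialSystem G M ι v) ℂ →
      Matrix (∀ v, FinalSystem r D v) (∀ v, FinalSystem r D v) ℂ,
    IsLOCC C ∧ ∀ ρ : Matrix (Fin D) (Fin D) ℂ, ρ.PosSemidef → ρ.trace = 1 →
      C (initialState G M U ρ) = finalState r ρ

end Task

/-! ### Koashi–Imoto decompositions and exact state merging

A tripartite vector in `ℂ^R ⊗ ℂ^A ⊗ ℂ^B` is a function `ψ : R → A → B → ℂ`. -/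

section Merging

/-- A Koashi–Imoto decomposition of a tripartite pure state `ψ`: identifications (`embA`, `embB`)
of `⨁ j, a_j^L ⊗ a_j^R` and `⨁ j, b_j^L ⊗ b_j^R` with subspaces of `ℂ^A` and `ℂ^B` such that
`ψ = ⨁ j, √(p j) ω_j ⊗ φ_j` with `ω_j ∈ a_j^L ⊗ b_j^L` and `φ_j ∈ R ⊗ a_j^R ⊗ b_j^R`.  The
subspaces then contain the supports of the reduced states of `ψ`; they are allowed, but not
required, to be all of `ℂ^A` and `ℂ^B`. -/
structure KoashiImotoDecomposition {R A B : Type} [Fintype R] [Fintype A] [Fintype B]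
    (ψ : R → A → B → ℂ) where
  J : ℕ
  aL : Fin J → ℕ
  aR : Fin J → ℕ
  bL : Fin J → ℕ
  bR : Fin J → ℕ
  embA : Matrix A (Σ j, Fin (aL j) × Fin (aR j)) ℂ
  embB : Matrix B (Σ j, Fin (bL j) × Fin (bR j)) ℂ
  embA_isometry : embAᴴ * embA = 1
  embB_isometry : embBᴴ * embB = 1
  p : Fin J → ℝ
  p_nonneg : ∀ j, 0 ≤ p j
  p_sum : ∑ j, p j = 1
  ω : ∀ j, Matrix (Fin (aL j)) (Fin (bL j)) ℂ
  ω_unit : ∀ j, ∑ x, ∑ y, ‖ω j x y‖ ^ 2 = 1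
  φ : ∀ j, R → Fin (aR j) → Fin (bR j) → ℂ
  φ_unit : ∀ j, ∑ r, ∑ x, ∑ y, ‖φ j r x y‖ ^ 2 = 1
  decomp : ∀ r a b, ψ r a b = ∑ j, (Real.sqrt (p j) : ℂ) *
    ∑ x : Fin (aL j) × Fin (aR j), ∑ y : Fin (bL j) × Fin (bR j),
      embA a ⟨j, x⟩ * embB b ⟨j, y⟩ * (ω j x.1 y.1 * φ j r x.2 y.2)

/-- The largest eigenvalue of the reduced state `tr_{b_j^L} |ω_j⟩⟨ω_j|` (whose matrix is
`ω_j ω_jᴴ`) on `a_j^L`. -/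
def KoashiImotoDecomposition.maxEigenvalue {R A B : Type}
    [Fintype R] [Fintype A] [Fintype B] {ψ : R → A → B → ℂ}
    (δ : KoashiImotoDecomposition ψ) (j : Fin δ.J) : ℝ :=
  ⨆ i, (Matrix.isHermitian_mul_conjTranspose_self (δ.ω j)).eigenvalues i

/-- `log₂ K ≥ max_j log₂ ⌈λ₀^{a_j^L} dim a_j^R⌉`. -/
def KoashiImotoDecomposition.CostAtMost {R A B : Type}
    [Fintype R] [Fintype A] [Fintype B] {ψ : R → A → B → ℂ}
    (δ : KoashiImotoDecomposition ψ) (K : ℕ) : Prop :=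
  ∀ j, Real.logb 2 ⌈δ.maxEigenvalue j * (δ.aR j : ℝ)⌉₊ ≤ Real.logb 2 K

/-- The vector `(1^{RB} ⊗ ⟨m|^A) (ψ ⊗ Φ_K⁺)`, where `m` is a vector on `A` and `A`'s half of
`Φ_K⁺`; the result lives on `R`, `B` and `B`'s half of `Φ_K⁺`. -/
def measured {R A B : Type} [Fintype A] {K : ℕ} (ψ : R → A → B → ℂ) (m : A × Fin K → ℂ) : R → B × Fin K → ℂ :=
  fun r y => ∑ a, ∑ i, star (m (a, i)) * (ψ r a y.1 * maxEnt K i y.2)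

open Classical in
/-- The vectors `m o` (`o : Fin n` the outcomes) form a measurement `∑ o, |m o⟩⟨m o| = 1` by
which `A` achieves exact state merging of `ψ` with the help of `Φ_K⁺`: for every outcome there is
an isometry `W` of `B`, from `B` and its half of `Φ_K⁺` to `B'`, `B` and an auxiliary system, that
takes the unnormalised state after the measurement to `ψ^{R B' B} ⊗ χ`.  Orthonormal bases are
included; the other families are orthonormal bases of an extension of the space by an auxiliary
system of `A`. -/
def IsExactMerging {R A B : Type} [Fintype A] [Fintype B] {K n : ℕ}
    (ψ : R → A → B → ℂ) (m : Fin n → A × Fin K → ℂ) : Prop :=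
  (∑ o, Matrix.vecMulVec (m o) (star (m o)) = 1) ∧
  ∀ o, ∃ (d : ℕ) (W : Matrix ((A × B) × Fin d) (B × Fin K) ℂ) (χ : Fin d → ℂ),
    Wᴴ * W = 1 ∧
    ∀ r a b i, ∑ y, W ((a, b), i) y * measured ψ (m o) r y = χ i * ψ r a b

/-- `m` is a measurement by which `A` achieves exact state merging of `ψ` with `Φ_K⁺`, provided
that one exists.  (Such an `m` can be chosen for every `ψ` and `K`; whether it does merge `ψ` is
not part of this notion.) -/
def IsMergingMeasurement {R A B : Type} [Fintype A] [Fintype B] {K n : ℕ}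
    (ψ : R → A → B → ℂ) (m : Fin n → A × Fin K → ℂ) : Prop :=
  (∃ (n' : ℕ) (m' : Fin n' → A × Fin K → ℂ), IsExactMerging ψ m') → IsExactMerging ψ m

end Merging

/-! ### Rooted trees, ascending labelings and the sequence of intermediate states -/

section Tree

variable {V : Type} [Fintype V]

/-- The parent of `v` in the tree `T` with root `r`: the vertex next to `v` on the path from `v`
to `r`. -/
def parent {T : SimpleGraph V} (hT : T.IsTree) (r v : V) : V :=
  (hT.existsUnique_path v r).choose.snd

/-- Ascending labelings: the vertex `v_k` is the one with `label v_k = k - 1`; the root is `v_1`,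
and on the path from the root to `v` no label exceeds that of `v`. -/
structure AscendingLabeling (T : SimpleGraph V) (r : V) where
  label : V ≃ Fin (Fintype.card V)
  label_root : (label r : ℕ) = 0
  ascending : ∀ (v : V) (q : T.Walk r v), q.IsPath → ∀ w ∈ q.support, label w ≤ label v

/-- The parent of a non-root vertex has a smaller label. -/
theorem AscendingLabeling.parent_lt {T : SimpleGraph V} (hT : T.IsTree) {r : V}
    (L : AscendingLabeling T r) {v : V} (hv : v ≠ r) : L.label (parent hT r v) < L.label v := by
  have hq := (hT.existsUnique_path v r).choose_spec.1
  set q := (hT.existsUnique_path v r).choose with hqdef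
  have hn : ¬ q.Nil := SimpleGraph.Walk.not_nil_of_ne hv
  have hadj : T.Adj v q.snd := q.adj_snd hn
  have hle : L.label q.snd ≤ L.label v := by
    refine L.ascending v q.reverse hq.reverse _ ?_
    rw [SimpleGraph.Walk.support_reverse, List.mem_reverse]
    exact q.getVert_mem_support 1
  refine lt_of_le_of_ne hle fun h => hadj.ne ?_
  exact (L.label.injective h).symm

/-- The `(k+1)`-st vertex `v_{k+1}`. -/
def AscendingLabeling.vertex {T : SimpleGraph V} {r : V} (L : AscendingLabeling T r) (k : ℕ)
    (hk : k < Fintype.card V) : V := L.label.symm ⟨k, hk⟩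

theorem AscendingLabeling.label_vertex {T : SimpleGraph V} {r : V} (L : AscendingLabeling T r)
    (k : ℕ) (hk : k < Fintype.card V) : (L.label (L.vertex k hk) : ℕ) = k := by
  simp [AscendingLabeling.vertex]

theorem AscendingLabeling.eq_vertex {T : SimpleGraph V} {r : V} (L : AscendingLabeling T r)
    {k : ℕ} (hk : k < Fintype.card V) {w : V} (h : (L.label w : ℕ) < k + 1)
    (h' : ¬ (L.label w : ℕ) < k) : L.vertex k hk = w := by
  rw [AscendingLabeling.vertex, Equiv.symm_apply_eq]
  ext
  simp only
  omega

theorem AscendingLabeling.label_parent_vertex {T : SimpleGraph V} (hT : T.IsTree) {r : V}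
    (L : AscendingLabeling T r) (k : ℕ) (hk : k + 1 < Fintype.card V) :
    (L.label (parent hT r (L.vertex (k + 1) hk)) : ℕ) < k + 1 := by
  have hne : L.vertex (k + 1) hk ≠ r := by
    intro h
    have h1 := L.label_vertex (k + 1) hk
    rw [h, L.label_root] at h1
    omega
  have h2 := L.parent_lt hT hne
  rw [Fin.lt_def, L.label_vertex] at h2
  exact h2

variable [DecidableEq V]

/-- Basis labels of the system `v` holds when the parties `v_1, …, v_k` remain (for `v` one of
them): its part of the physical system and, for each child `c` of `v` that is no longer among
them, `v`'s half of the resource state `Φ_{M {p(c), c}}⁺`. -/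
abbrev HeldSystem {T : SimpleGraph V} (hT : T.IsTree) {r : V} (L : AscendingLabeling T r)
    (M : Sym2 V → ℕ) (ι : V → Type) (k : ℕ) (v : V) : Type :=
  ι v × (∀ c : V, parent hT r c = v → k ≤ (L.label c : ℕ) → Fin (M s(parent hT r c, c)))

/-- Basis labels of the joint system of `v_1, …, v_k` when these parties remain. -/
abbrev JointSystem {T : SimpleGraph V} (hT : T.IsTree) {r : V} (L : AscendingLabeling T r)
    (M : Sym2 V → ℕ) (ι : V → Type) (k : ℕ) : Type :=
  ∀ w : V, (L.label w : ℕ) < k → HeldSystem hT L M ι k w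

/-- Basis labels of the joint system of `v_1, …, v_k` when `v_1, …, v_{k+1}` remain. -/
abbrev RestSystem {T : SimpleGraph V} (hT : T.IsTree) {r : V} (L : AscendingLabeling T r)
    (M : Sym2 V → ℕ) (ι : V → Type) (k : ℕ) : Type :=
  ∀ w : V, (L.label w : ℕ) < k → HeldSystem hT L M ι (k + 1) w

variable {T : SimpleGraph V} (hT : T.IsTree) {r : V} (L : AscendingLabeling T r)
  (M : Sym2 V → ℕ) {ι : V → Type} {D : ℕ}

/-- A vector in `R ⊗ (v_1 ⋯ v_{k+1})` as a tripartite vector in `R ⊗ v_{k+1} ⊗ (v_1 ⋯ v_k)`. -/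
def splitLast (k : ℕ) (hk : k < Fintype.card V)
    (ψ : Fin D → JointSystem hT L M ι (k + 1) → ℂ) :
    Fin D → HeldSystem hT L M ι (k + 1) (L.vertex k hk) → RestSystem hT L M ι k → ℂ :=
  fun l a b => ψ l fun w hw =>
    if h : (L.label w : ℕ) < k then b w h else L.eq_vertex hk hw h ▸ a

/-- A vector on `R`, the systems of `v_1, …, v_{k+1}` before the merging of `v_{k+2}`, and the
parent's half of the resource state of the edge `{p(v_{k+2}), v_{k+2}}`, the latter regarded as
part of the system of `p(v_{k+2})`. -/
def absorb (k : ℕ) (hk : k + 1 < Fintype.card V)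
    (ψ : Fin D → RestSystem hT L M ι (k + 1) ×
      Fin (M s(parent hT r (L.vertex (k + 1) hk), L.vertex (k + 1) hk)) → ℂ) :
    Fin D → JointSystem hT L M ι (k + 1) → ℂ :=
  fun l x => ψ l
    (fun w hw => ((x w hw).1, fun c hc hle => (x w hw).2 c hc (Nat.le_of_succ_le hle)),
      (x _ (L.label_parent_vertex hT k hk)).2 (L.vertex (k + 1) hk) rfl
        (L.label_vertex (k + 1) hk).ge)

/-- `ψ / ‖ψ‖`. -/
def normalized {X Y : Type} [Fintype X] [Fintype Y] (ψ : X → Y → ℂ) : X → Y → ℂ :=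
  fun x y => ψ x y / (Real.sqrt (∑ x', ∑ y', ‖ψ x' y'‖ ^ 2) : ℂ)

/-- The cost bound for sequential exact state merging from the state `ψ = Φ^k` of `R` and
`v_1, …, v_k` on.  For `k ≥ 2`: for a Koashi–Imoto decomposition of `Φ^k`, with `R`, `v_k` and
`v_1 ⋯ v_{k-1}` in the roles of `R`, `A` and `B`,
`log₂ M_{{p(v_k), v_k}} ≥ max_j log₂ ⌈λ₀ dim⌉` holds; and, with `v_k` using a merging measurement
for `Φ^k`, for every outcome `m` of non-zero probability the same is true from the state
`Φ^{k-1} ∝ (1 ⊗ ⟨m|)(Φ^k ⊗ Φ_{M_{{p(v_k), v_k}}}⁺)` on. -/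
def MergingCostBound [∀ v, Fintype (ι v)] :
    (k : ℕ) → k ≤ Fintype.card V → (Fin D → JointSystem hT L M ι k → ℂ) → Prop
  | 0, _, _ => True
  | 1, _, _ => True
  | k + 2, hk, ψ =>
    (∃ δ : KoashiImotoDecomposition (splitLast hT L M (k + 1) hk ψ),
      δ.CostAtMost (M s(parent hT r (L.vertex (k + 1) hk), L.vertex (k + 1) hk))) ∧
    ∃ (n : ℕ) (m : Fin n → HeldSystem hT L M ι (k + 2) (L.vertex (k + 1) hk) ×
        Fin (M s(parent hT r (L.vertex (k + 1) hk), L.vertex (k + 1) hk)) → ℂ),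
      IsMergingMeasurement (splitLast hT L M (k + 1) hk ψ) m ∧
      ∀ o, measured (splitLast hT L M (k + 1) hk ψ) (m o) ≠ 0 →
        MergingCostBound (k + 1) (Nat.le_of_succ_le hk)
          (normalized (absorb hT L M k hk (measured (splitLast hT L M (k + 1) hk ψ) (m o))))

/-- The state `Φ^N = (1^R ⊗ U) D^(-1/2) ∑ l, |l⟩ ⊗ |l⟩` of `R` and `v_1, …, v_N`. -/
def referenceState (U : Matrix (∀ v, ι v) (Fin D) ℂ) :
    Fin D → JointSystem hT L M ι (Fintype.card V) → ℂ :=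
  fun l x => ((1 / Real.sqrt D : ℝ) : ℂ) * U (fun v => (x v (L.label v).isLt).1) l

end Tree

end

open scoped Kronecker

/-!
Exact merging at a vertex multiplies the reduced state on the reference `R` by the probability of
the outcome.  Hence all the intermediate states keep a maximally mixed `R`, that is, the input
stays isometrically encoded in the systems of the remaining parties, and the root decodes it once
it is the only one left.

That a cost of at most `K` suffices for exact merging rests on two facts.  Vectors with the same
reduced state on `R` differ by an isometry of `B`, so it is enough that each outcome reveals
neither the Koashi–Imoto block `j` nor anything about `a_j^R`.  And since `λ_i * dim a_j^R ≤ K`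
for all eigenvalues `λ_i`, the numbers `λ_i / K` are the marginals of a random injection of the
basis of `⨁ j, a_j^R` into that of `⨁ j, a_j^L ⊗ ℂ^K`, by Birkhoff's theorem; with independent
random signs attached, such an injection is a measurement of this kind.
-/

noncomputable section

/-! ### Gram matrices and isometries -/

/-- The Gram matrix of the components of a vector of `ℂ^R ⊗ ℂ^X` along the basis of the reference
`ℂ^R`, that is, the transpose of its reduced state on `ℂ^R`. -/
def gram {R X : Type*} [Fintype X] (ψ : R → X → ℂ) : Matrix R R ℂ :=
  Matrix.gram ℂ fun r => WithLp.toLp 2 (ψ r)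

theorem gram_apply {R X : Type*} [Fintype X] (ψ : R → X → ℂ) (r r' : R) :
    gram ψ r r' = ∑ x, star (ψ r x) * ψ r' x :=
  dotProduct_comm (ψ r') (star (ψ r))

theorem gram_comp_equiv {R X Y : Type*} [Fintype X] [Fintype Y] (e : X ≃ Y) (ψ : R → Y → ℂ) :
    gram (fun r x => ψ r (e x)) = gram ψ := by
  ext r r'
  simp only [gram_apply, e.sum_comp fun y => star (ψ r y) * ψ r' y]

theorem gram_smul {R X : Type*} [Fintype X] (c : ℂ) (ψ : R → X → ℂ) :
    gram (c • ψ) = (star c * c) • gram ψ := by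
  ext r r'
  simp only [gram_apply, Pi.smul_apply, smul_eq_mul, star_mul', Matrix.smul_apply, Finset.mul_sum]
  exact Finset.sum_congr rfl fun x _ => by ring

theorem gram_mulVec {R X Y : Type*} [Fintype X] [DecidableEq X] [Fintype Y] {W : Matrix Y X ℂ}
    (hW : Wᴴ * W = 1) (ψ : R → X → ℂ) : gram (fun r => W *ᵥ ψ r) = gram ψ := by
  ext r r'
  simp only [gram_apply]
  change star (W *ᵥ ψ r) ⬝ᵥ W *ᵥ ψ r' = star (ψ r) ⬝ᵥ ψ r'
  rw [Matrix.star_mulVec, Matrix.dotProduct_mulVec, Matrix.vecMul_vecMul, hW, Matrix.vecMul_one]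

theorem trace_gram {R X : Type*} [Fintype R] [Fintype X] (ψ : R → X → ℂ) :
    (gram ψ).trace = ((∑ r, ∑ x, ‖ψ r x‖ ^ 2 : ℝ) : ℂ) := by
  simp [Matrix.trace, gram_apply, ← Complex.conj_mul']

section Isometry

variable {𝕜 R E F : Type*} [RCLike 𝕜] [NormedAddCommGroup E] [InnerProductSpace 𝕜 E]
  [NormedAddCommGroup F] [InnerProductSpace 𝕜 F]

theorem norm_linearCombination_eq_of_gram_eq {u : R → E} {v : R → F}
    (h : Matrix.gram 𝕜 u = Matrix.gram 𝕜 v) (a : R →₀ 𝕜) :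
    ‖Finsupp.linearCombination 𝕜 u a‖ = ‖Finsupp.linearCombination 𝕜 v a‖ := by
  have h_inner : ∀ r r', inner 𝕜 (u r) (u r') = inner 𝕜 (v r) (v r') := fun r r' =>
    congr_fun₂ h r r'
  rw [← sq_eq_sq₀ (norm_nonneg _) (norm_nonneg _), ← inner_self_eq_norm_sq (𝕜 := 𝕜),
    ← inner_self_eq_norm_sq (𝕜 := 𝕜)]
  simp only [Finsupp.linearCombination_apply, Finsupp.sum_inner, Finsupp.inner_sum,
    inner_smul_left, inner_smul_right, h_inner]

theorem exists_linearIsometry_of_gram_eq [FiniteDimensional 𝕜 E] {u v : R → E}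
    (h : Matrix.gram 𝕜 u = Matrix.gram 𝕜 v) : ∃ L : E →ₗᵢ[𝕜] E, ∀ r, L (u r) = v r := by
  let S := Finsupp.linearCombination 𝕜 u
  let T := Finsupp.linearCombination 𝕜 v
  have h_norm : ∀ a, ‖S a‖ = ‖T a‖ := norm_linearCombination_eq_of_gram_eq h
  have h_ker : LinearMap.ker S ≤ LinearMap.ker T := fun a ha => by
    rwa [LinearMap.mem_ker, ← norm_eq_zero, ← h_norm, norm_eq_zero]
  let g : LinearMap.range S →ₗ[𝕜] E :=
    (LinearMap.ker S).liftQ T h_ker ∘ₗ S.quotKerEquivRange.symm.toLinearMap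
  have hg : ∀ a, g ⟨S a, a, rfl⟩ = T a := fun a => by
    rw [LinearMap.comp_apply, LinearEquiv.coe_coe,
      LinearMap.quotKerEquivRange_symm_apply_image S a ⟨a, rfl⟩, Submodule.mkQ_apply,
      Submodule.liftQ_apply]
  let L : LinearMap.range S →ₗᵢ[𝕜] E := ⟨g, by
    rintro ⟨_, a, rfl⟩
    exact (congrArg norm (hg a)).trans (h_norm a).symm⟩
  refine ⟨L.extend, fun r => ?_⟩
  have hS : S (Finsupp.single r 1) = u r := by simp [S]
  have hT : T (Finsupp.single r 1) = v r := by simp [T]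
  rw [← hS, ← hT]
  exact (L.extend_apply ⟨S (Finsupp.single r 1), _, rfl⟩).trans (hg _)

end Isometry

theorem conjTranspose_mul_self_toEuclideanLin_symm {X Y : Type*} [Fintype X] [DecidableEq X]
    [Fintype Y] (L : EuclideanSpace ℂ X →ₗᵢ[ℂ] EuclideanSpace ℂ Y) :
    (Matrix.toEuclideanLin.symm L.toLinearMap)ᴴ * Matrix.toEuclideanLin.symm L.toLinearMap = 1 := by
  classical
  apply Matrix.toEuclideanLin.injective
  ext x : 2
  refine ext_inner_left ℂ fun y => ?_
  simp [Matrix.toLpLin_mul_same, Matrix.toEuclideanLin_conjTranspose_eq_adjoint]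

theorem exists_isometry_of_gram_eq {R X Y : Type*} [Fintype X] [DecidableEq X] [Fintype Y]
    (hXY : Fintype.card X ≤ Fintype.card Y) {ψ : R → X → ℂ} {φ : R → Y → ℂ}
    (h : gram ψ = gram φ) : ∃ W : Matrix Y X ℂ, Wᴴ * W = 1 ∧ ∀ r, W *ᵥ ψ r = φ r := by
  classical
  obtain ⟨f⟩ := Function.Embedding.nonempty_of_card_le hXY
  let S : Matrix Y X ℂ := (1 : Matrix Y Y ℂ).submatrix id f
  have hS : Sᴴ * S = 1 := by
    ext x x'
    simp [S, Matrix.mul_apply, Matrix.one_apply, f.injective.eq_iff]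
  obtain ⟨L, hL⟩ := exists_linearIsometry_of_gram_eq ((gram_mulVec hS ψ).trans h)
  let G : Matrix Y Y ℂ := Matrix.toEuclideanLin.symm L.toLinearMap
  have hG : Gᴴ * G = 1 := conjTranspose_mul_self_toEuclideanLin_symm L
  refine ⟨G * S, ?_, fun r => ?_⟩
  · rw [Matrix.conjTranspose_mul, Matrix.mul_assoc, ← Matrix.mul_assoc Gᴴ, hG, Matrix.one_mul, hS]
  · have h_apply := congrArg WithLp.ofLp (hL r)
    rwa [← L.coe_toLinearMap, ← Matrix.toEuclideanLin.apply_symm_apply L.toLinearMap,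
      Matrix.toLpLin_toLp, Matrix.toLin'_apply, Matrix.mulVec_mulVec] at h_apply

/-! ### Random injections and random signs -/

/-- Row stochastic matrices with column sums at most `1`.  These are the matrices of probabilities
`Q x i = ℙ (f x = i)` of random injections `f : X ↪ I`. -/
structure IsInjectionMarginal {X I : Type*} [Fintype X] [Fintype I] (Q : Matrix X I ℝ) : Prop where
  nonneg : ∀ x i, 0 ≤ Q x i
  row_sum : ∀ x, ∑ i, Q x i = 1
  col_sum_le : ∀ i, ∑ x, Q x i ≤ 1

section InjectionMarginal

variable {X I : Type*} [Fintype X] [Fintype I] {Q : Matrix X I ℝ}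

theorem IsInjectionMarginal.sum_one_sub_col_sum (hQ : IsInjectionMarginal Q) :
    ∑ i, (1 - ∑ x, Q x i) = (Fintype.card I : ℝ) - Fintype.card X := by
  rw [Finset.sum_sub_distrib, Finset.sum_comm, Finset.sum_congr rfl fun x _ => hQ.row_sum x]
  simp

theorem IsInjectionMarginal.card_le (hQ : IsInjectionMarginal Q) :
    Fintype.card X ≤ Fintype.card I := by
  have h_nonneg := Finset.sum_nonneg fun i (_ : i ∈ Finset.univ) => sub_nonneg.2 (hQ.col_sum_le i)
  rw [hQ.sum_one_sub_col_sum, sub_nonneg] at h_nonneg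
  exact_mod_cast h_nonneg

theorem IsInjectionMarginal.exists_doublyStochastic [DecidableEq I] (hQ : IsInjectionMarginal Q) :
    ∃ (e : X ↪ I) (P : Matrix I I ℝ), P ∈ doublyStochastic ℝ I ∧ P.submatrix e id = Q := by
  obtain ⟨n, hn⟩ := Nat.exists_eq_add_of_le hQ.card_le
  obtain ⟨E⟩ : Nonempty (X ⊕ Fin n ≃ I) := ⟨Fintype.equivOfCardEq (by simp [hn])⟩
  have h_deficit : ∑ i, (1 - ∑ x, Q x i) = n := by simp [hQ.sum_one_sub_col_sum, hn]
  have h_nonneg : ∀ i, 0 ≤ 1 - ∑ x, Q x i := fun i => sub_nonneg.2 (hQ.col_sum_le i)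
  let R (y : X ⊕ Fin n) (i : I) : ℝ := y.elim (Q · i) fun _ => (1 - ∑ x, Q x i) / n
  refine ⟨Function.Embedding.inl.trans E.toEmbedding, Matrix.of fun y => R (E.symm y),
    mem_doublyStochastic_iff_sum.2 ⟨fun y i => ?_, fun y => ?_, fun i => ?_⟩, ?_⟩
  · obtain ⟨x | z, rfl⟩ := E.surjective y
    · simpa [R] using hQ.nonneg x i
    · simpa [R] using div_nonneg (h_nonneg i) n.cast_nonneg
  · obtain ⟨x | z, rfl⟩ := E.surjective y
    · simpa [R] using hQ.row_sum x
    · have hn0 : (n : ℝ) ≠ 0 := Nat.cast_ne_zero.2 z.pos.ne'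
      simp [R, ← Finset.sum_div, h_deficit, hn0]
  · have h_zero : (n : ℝ) = 0 → 1 - ∑ x, Q x i = 0 := fun h0 =>
      (Finset.sum_eq_zero_iff_of_nonneg fun i _ => h_nonneg i).1 (h_deficit.trans h0) i
        (Finset.mem_univ i)
    simp only [Matrix.of_apply, E.symm.sum_comp fun y => R y i,
      Fintype.sum_sum_type]
    simp [R, mul_div_cancel_of_imp' h_zero]
  · ext x i
    simp [R]

theorem IsInjectionMarginal.exists_random_injection [DecidableEq I] (hQ : IsInjectionMarginal Q) :
    ∃ (w : Equiv.Perm I → ℝ) (f : Equiv.Perm I → X ↪ I), (∀ g, 0 ≤ w g) ∧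
      ∀ x i, ∑ g, (if f g x = i then w g else 0) = Q x i := by
  obtain ⟨e, P, hP, rfl⟩ := hQ.exists_doublyStochastic
  obtain ⟨w, hw_nonneg, -, hwP⟩ := exists_eq_sum_perm_of_mem_doublyStochastic hP
  refine ⟨w, fun g => e.trans g.toEmbedding, hw_nonneg, fun x i => ?_⟩
  have h_entry := congr_fun₂ hwP (e x) i
  rw [Matrix.sum_apply] at h_entry
  simpa [Equiv.Perm.permMatrix, PEquiv.toMatrix_apply] using h_entry

end InjectionMarginal

theorem sum_units_mul_units {I : Type*} [Fintype I] [DecidableEq I] (i i' : I) :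
    ∑ ε : I → ℤˣ, ((ε i : ℤ) : ℂ) * ((ε i' : ℤ) : ℂ) =
      if i = i' then (Fintype.card (I → ℤˣ) : ℂ) else 0 := by
  split_ifs with h
  · have h_sq : ∀ ε : I → ℤˣ, ((ε i : ℤ) : ℂ) * ((ε i' : ℤ) : ℂ) = 1 := fun ε => by
      rw [← h, ← Int.cast_mul, ← Units.val_mul, Int.units_mul_self, Units.val_one, Int.cast_one]
    simp [h_sq]
  · have h_flip := Equiv.sum_comp (Equiv.mulLeft (Pi.mulSingle i (-1)))
      fun ε : I → ℤˣ => ((ε i : ℤ) : ℂ) * ((ε i' : ℤ) : ℂ)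
    simp only [Equiv.coe_mulLeft, Pi.mul_apply, Pi.mulSingle_eq_same,
      Pi.mulSingle_eq_of_ne' h, one_mul, neg_mul, Units.val_neg, Int.cast_neg,
      Finset.sum_neg_distrib] at h_flip
    exact self_eq_neg.1 h_flip.symm

/-- The amplitudes `±s g` at the pairs `(x, f g x)`, one column for each `g` and each choice of
signs: a signed random injection with the square roots of the probabilities in the role of `s`. -/
def signedInjection {X I G : Type*} [DecidableEq I] (f : G → X ↪ I) (s : G → ℝ) :
    Matrix (X × I) (G × (I → ℤˣ)) ℂ :=
  Matrix.of fun y o => if f o.1 y.1 = y.2 then ((o.2 y.2 : ℤ) : ℂ) * s o.1 else 0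

section SignedInjection

variable {X I G : Type*} [DecidableEq I] (f : G → X ↪ I) (s : G → ℝ)

theorem signedInjection_apply (x : X) (i : I) (g : G) (ε : I → ℤˣ) :
    signedInjection f s (x, i) (g, ε) = if f g x = i then ((ε i : ℤ) : ℂ) * s g else 0 := rfl

theorem star_signedInjection (y : X × I) (o : G × (I → ℤˣ)) :
    star (signedInjection f s y o) = signedInjection f s y o := by
  simp only [signedInjection, Matrix.of_apply]
  split_ifs <;> simp

variable [Fintype I] [DecidableEq X]

theorem sum_signs_signedInjection (g : G) (x x' : X) (i i' : I) :
    ∑ ε, signedInjection f s (x, i) (g, ε) * signedInjection f s (x', i') (g, ε) =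
      if (x, i) = (x', i') then
        if f g x = i then (Fintype.card (I → ℤˣ) * s g ^ 2 : ℂ) else 0
      else 0 := by
  simp only [signedInjection_apply]
  by_cases hx : f g x = i ∧ f g x' = i'
  · obtain ⟨rfl, rfl⟩ := hx
    simp only [if_true, mul_mul_mul_comm _ (s g : ℂ), ← Finset.sum_mul, sum_units_mul_units,
      Prod.mk_inj, (f g).injective.eq_iff, and_self, ite_mul, zero_mul, sq]
  · have h_zero : ∀ ε : I → ℤˣ, ((if f g x = i then ((ε i : ℤ) : ℂ) * s g else 0) *
        if f g x' = i' then ((ε i' : ℤ) : ℂ) * s g else 0) = 0 := fun ε => by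
      grind
    rw [Fintype.sum_congr _ _ h_zero, Finset.sum_const_zero]
    grind

theorem signedInjection_mul_conjTranspose [Fintype G] :
    signedInjection f s * (signedInjection f s)ᴴ = Matrix.diagonal fun y =>
      ((∑ g, if f g y.1 = y.2 then Fintype.card (I → ℤˣ) * s g ^ 2 else 0 : ℝ) : ℂ) := by
  ext ⟨x, i⟩ ⟨x', i'⟩
  simp only [Matrix.mul_apply, Matrix.conjTranspose_apply, star_signedInjection,
    Fintype.sum_prod_type, sum_signs_signedInjection, Matrix.diagonal_apply]
  split_ifs
  · simp only [Complex.ofReal_sum, apply_ite Complex.ofReal, Complex.ofReal_mul, Complex.ofReal_pow,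
      Complex.ofReal_natCast, Complex.ofReal_zero]
  · exact Finset.sum_const_zero

theorem sum_signedInjection_mul_star (o : G × (I → ℤˣ)) (x x' : X) :
    ∑ i, signedInjection f s (x, i) o * star (signedInjection f s (x', i) o) =
      if x = x' then ((s o.1 ^ 2 : ℝ) : ℂ) else 0 := by
  obtain ⟨g, ε⟩ := o
  have h_sign : ((ε (f g x) : ℤ) : ℂ) * ((ε (f g x) : ℤ) : ℂ) = 1 := by
    rw [← Int.cast_mul, ← Units.val_mul, Int.units_mul_self, Units.val_one, Int.cast_one]
  simp only [star_signedInjection]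
  simp only [signedInjection_apply]
  rw [Fintype.sum_eq_single (f g x) fun i hi => by simp [hi.symm]]
  by_cases h : x = x'
  · subst h
    rw [if_pos rfl, if_pos rfl, mul_mul_mul_comm, h_sign, one_mul, ← sq,
      Complex.ofReal_pow]
  · simp [h, Ne.symm h]

end SignedInjection

theorem IsInjectionMarginal.exists_signed_ensemble {X I : Type} [Fintype X] [Fintype I]
    [DecidableEq X] [DecidableEq I] {Q : Matrix X I ℝ} (hQ : IsInjectionMarginal Q) :
    ∃ (Ω : Type) (_ : Fintype Ω) (a : Matrix (X × I) Ω ℂ) (c : Ω → ℝ), (∀ o, 0 ≤ c o) ∧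
      a * aᴴ = Matrix.diagonal (fun y => (Q y.1 y.2 : ℂ)) ∧
      ∀ o x x', ∑ i, a (x, i) o * star (a (x', i) o) = if x = x' then (c o : ℂ) else 0 := by
  obtain ⟨w, f, hw, hwQ⟩ := hQ.exists_random_injection
  let n := Fintype.card (I → ℤˣ)
  have hn : (n : ℝ) ≠ 0 := Nat.cast_ne_zero.2 Fintype.card_ne_zero
  let s (g : Equiv.Perm I) : ℝ := √(w g / n)
  have hs : ∀ g, n * s g ^ 2 = w g := fun g => by
    rw [Real.sq_sqrt (div_nonneg (hw g) n.cast_nonneg), mul_div_cancel₀ _ hn]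
  refine ⟨_, inferInstance, signedInjection f s, _, fun o => sq_nonneg (s o.1), ?_,
    sum_signedInjection_mul_star f s⟩
  rw [signedInjection_mul_conjTranspose]
  simp only [n, hs, hwQ]

theorem exists_mul_conjTranspose_eq_one_of_eq_diagonal {Y Ω : Type*} [Fintype Y] [DecidableEq Y]
    [Fintype Ω] {a : Matrix Y Ω ℂ} {q : Y → ℝ} (h : a * aᴴ = Matrix.diagonal fun y => (q y : ℂ)) :
    ∃ v : Matrix Y (Ω ⊕ Y) ℂ, v * vᴴ = 1 ∧
      Matrix.diagonal (fun y => ((√(q y) : ℝ) : ℂ)) * v = Matrix.fromCols a 0 := by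
  have h_row : ∀ y, ∑ o, ‖a y o‖ ^ 2 = q y := fun y => by
    have h_entry := congr_fun₂ h y y
    simp only [Matrix.mul_apply, Matrix.conjTranspose_apply, Matrix.diagonal_apply_eq,
      Complex.star_def, Complex.mul_conj'] at h_entry
    exact_mod_cast h_entry
  have hq : ∀ y, 0 ≤ q y := fun y => h_row y ▸ Finset.sum_nonneg fun o _ => sq_nonneg _
  have ha_zero : ∀ y, q y = 0 → ∀ o, a y o = 0 := fun y hy o => by
    have := (Finset.sum_eq_zero_iff_of_nonneg fun o _ => sq_nonneg _).1 ((h_row y).trans hy) o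
      (Finset.mem_univ o)
    simpa using this
  let s (y : Y) : ℂ := (√(q y) : ℝ)
  let z (y : Y) : ℂ := if q y = 0 then 1 else 0
  have hs : ∀ y, q y ≠ 0 → s y ≠ 0 := fun y hy => by
    simpa [s, Real.sqrt_eq_zero (hq y)] using hy
  refine ⟨Matrix.fromCols (Matrix.diagonal (fun y => (s y)⁻¹) * a) (Matrix.diagonal z), ?_, ?_⟩
  · rw [Matrix.conjTranspose_fromCols_eq_fromRows_conjTranspose, Matrix.fromCols_mul_fromRows,
      Matrix.conjTranspose_mul, Matrix.mul_assoc, ← Matrix.mul_assoc a, h]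
    simp only [Matrix.diagonal_conjTranspose, Matrix.diagonal_mul_diagonal, Matrix.diagonal_add,
      ← Matrix.diagonal_one]
    congr 1
    ext y
    by_cases hy : q y = 0
    · simp [s, z, hy]
    · have h_sq : (q y : ℂ) = s y * s y := by
        rw [← Complex.ofReal_mul, Real.mul_self_sqrt (hq y)]
      have hs_star : star (s y) = s y := Complex.conj_ofReal _
      simp [z, hy, h_sq, hs_star, hs y hy]
  · rw [Matrix.mul_fromCols]
    ext y (o | y')
    · by_cases hy : q y = 0
      · simp [ha_zero y hy]
      · simpa [s] using mul_inv_cancel_left₀ (hs y hy) (a y o)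
    · by_cases hy : q y = 0 <;> simp [z, hy, Matrix.diagonal_apply]

theorem IsInjectionMarginal.exists_ensemble {X I : Type} [Fintype X] [Fintype I]
    [DecidableEq X] [DecidableEq I] {Q : Matrix X I ℝ} (hQ : IsInjectionMarginal Q) :
    ∃ (Ω : Type) (_ : Fintype Ω) (v : Matrix (X × I) Ω ℂ) (c : Ω → ℝ), (∀ o, 0 ≤ c o) ∧
      v * vᴴ = 1 ∧ ∀ o x x', ∑ i, ((√(Q x i) : ℝ) * v (x, i) o) *
        star ((√(Q x' i) : ℝ) * v (x', i) o) = if x = x' then (c o : ℂ) else 0 := by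
  obtain ⟨Ω, _, a, c, hc, ha, hac⟩ := hQ.exists_signed_ensemble
  obtain ⟨v, hv, hva⟩ := exists_mul_conjTranspose_eq_one_of_eq_diagonal ha
  have h_entry : ∀ x i o, ((√(Q x i) : ℝ) : ℂ) * v (x, i) o = Matrix.fromCols a 0 (x, i) o :=
    fun x i o => by rw [← hva, Matrix.diagonal_mul]
  refine ⟨_, inferInstance, v, Sum.elim c 0, Sum.forall.2 ⟨hc, fun _ => le_rfl⟩, hv, ?_⟩
  rintro (o | y) x x' <;> simp only [h_entry]
  · exact hac o x x'
  · simp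

/-! ### Partial traces and uninformative effects -/

/-- The partial trace of an operator on `ℂ^α ⊗ ℂ^β` over `ℂ^α`. -/
def partialTraceLeft {α β : Type*} [Fintype α] (Z : Matrix (α × β) (α × β) ℂ) : Matrix β β ℂ :=
  Matrix.of fun b b' => ∑ a, Z (a, b) (a, b')

section PartialTrace

variable {α β : Type*} [Fintype α]

theorem partialTraceLeft_apply (Z : Matrix (α × β) (α × β) ℂ) (b b' : β) :
    partialTraceLeft Z b b' = ∑ a, Z (a, b) (a, b') := rfl

theorem partialTraceLeft_kronecker_one [DecidableEq β] (ρ : Matrix α α ℂ) :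
    partialTraceLeft (ρ ⊗ₖ (1 : Matrix β β ℂ)) = ρ.trace • 1 := by
  ext b b'
  simp only [partialTraceLeft_apply, Matrix.kroneckerMap_apply, Matrix.smul_apply, smul_eq_mul,
    Matrix.trace, Matrix.diag_apply, Finset.sum_mul]

variable [Fintype β]

theorem partialTraceLeft_mul_kronecker_one_comm [DecidableEq β] (Z : Matrix (α × β) (α × β) ℂ)
    (S : Matrix α α ℂ) :
    partialTraceLeft (Z * (S ⊗ₖ 1)) = partialTraceLeft ((S ⊗ₖ 1) * Z) := by
  ext b b'
  simp only [partialTraceLeft_apply, Matrix.mul_apply, Matrix.kroneckerMap_apply,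
    Matrix.one_apply, Fintype.sum_prod_type, mul_ite, ite_mul, mul_one, mul_zero, zero_mul,
    Finset.sum_ite_eq, Finset.sum_ite_eq', Finset.mem_univ, if_true]
  rw [Finset.sum_comm]
  exact Finset.sum_congr rfl fun a _ => Finset.sum_congr rfl fun a' _ => mul_comm _ _

theorem trace_mul_one_kronecker [DecidableEq α] (Z : Matrix (α × β) (α × β) ℂ) (S : Matrix β β ℂ) :
    (Z * (1 ⊗ₖ S)).trace = (partialTraceLeft Z * S).trace := by
  simp only [Matrix.trace, Matrix.diag_apply, Matrix.mul_apply, partialTraceLeft_apply,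
    Matrix.kroneckerMap_apply, Matrix.one_apply, Fintype.sum_prod_type, mul_ite, ite_mul, one_mul,
    mul_zero, zero_mul, Finset.sum_ite_irrel, Finset.sum_const_zero, Finset.sum_ite_eq',
    Finset.mem_univ, if_true, Finset.sum_mul]
  rw [Finset.sum_comm]
  refine Finset.sum_congr rfl fun b _ => ?_
  rw [Finset.sum_comm]

theorem partialTraceLeft_mul_diagonal_kronecker_one_apply [DecidableEq α] [DecidableEq β]
    (Z : Matrix (α × β) (α × β) ℂ) (d : α → ℂ) (b b' : β) :
    partialTraceLeft (Z * (Matrix.diagonal d ⊗ₖ (1 : Matrix β β ℂ))) b b' =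
      ∑ a, Z (a, b) (a, b') * d a := by
  rw [← Matrix.diagonal_one, Matrix.diagonal_kronecker_diagonal]
  simp only [partialTraceLeft_apply, Matrix.mul_diagonal, mul_one]

end PartialTrace

/-- The effect on `ℂ^A` of the outcome of a measurement on `ℂ^A ⊗ ℂ^K` that projects onto `m`, when
`ℂ^K` is maximally mixed. -/
def effect {A : Type*} {K : ℕ} (m : A × Fin K → ℂ) : Matrix A A ℂ :=
  (K : ℂ)⁻¹ • (Matrix.of (Function.curry m) * (Matrix.of (Function.curry m))ᴴ)

section Effect

variable {A A' : Type*} [Fintype A] {K : ℕ}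

theorem effect_apply (m : A' × Fin K → ℂ) (a a' : A') :
    effect m a a' = (K : ℂ)⁻¹ * ∑ k, m (a, k) * star (m (a', k)) := rfl

theorem effect_kronecker_one_mulVec (G : Matrix A' A ℂ) (m : A × Fin K → ℂ) :
    effect ((G ⊗ₖ (1 : Matrix (Fin K) (Fin K) ℂ)) *ᵥ m) = G * effect m * Gᴴ := by
  have h_curry : Matrix.of (Function.curry ((G ⊗ₖ (1 : Matrix (Fin K) (Fin K) ℂ)) *ᵥ m)) =
      G * Matrix.of (Function.curry m) := by
    ext a k
    simp [Matrix.mulVec, dotProduct, Fintype.sum_prod_type, Matrix.mul_apply, Matrix.one_apply,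
      Function.curry]
  rw [effect, h_curry, Matrix.conjTranspose_mul, effect, Matrix.mul_smul, Matrix.smul_mul]
  simp only [Matrix.mul_assoc]

theorem sum_effect [DecidableEq A'] {Ω : Type*} [Fintype Ω] (hK : 0 < K)
    {m : Ω → A' × Fin K → ℂ} (hm : ∑ o, Matrix.vecMulVec (m o) (star (m o)) = 1) :
    ∑ o, effect (m o) = 1 := by
  ext a a'
  have h_entry : ∀ k, ∑ o, m o (a, k) * star (m o (a', k)) = if a = a' then 1 else 0 := fun k => by
    have := congr_fun₂ hm (a, k) (a', k)
    simpa [Matrix.sum_apply, Matrix.vecMulVec_apply, Matrix.one_apply] using this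
  have hK' : (K : ℂ) ≠ 0 := Nat.cast_ne_zero.2 hK.ne'
  simp only [Matrix.sum_apply, effect_apply, ← Finset.mul_sum]
  rw [Finset.sum_comm]
  simp only [h_entry, Matrix.one_apply]
  split_ifs <;> simp [hK']

end Effect

/-- The effect `X` on `⨁ j, L j ⊗ E j` has weight `c` in every state that is `ρ j ⊗ σ` on some
block `j`: it tells nothing about `j` and `σ`. -/
def IsUninformative {J : Type*} [DecidableEq J] {L E : J → Type*} [∀ j, Fintype (L j)]
    [∀ j, Fintype (E j)] [∀ j, DecidableEq (E j)] (ρ : ∀ j, Matrix (L j) (L j) ℂ)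
    (X : Matrix (Σ j, L j × E j) (Σ j, L j × E j) ℂ) (c : ℝ) : Prop :=
  ∀ j, partialTraceLeft (Matrix.blockDiag' X j * (ρ j ⊗ₖ 1)) = (c : ℂ) • 1

theorem trace_eq_sum_trace_blockDiag' {J : Type*} [Fintype J] {m : J → Type*} [∀ j, Fintype (m j)]
    (X : Matrix (Σ j, m j) (Σ j, m j) ℂ) : X.trace = ∑ j, (Matrix.blockDiag' X j).trace :=
  Fintype.sum_sigma _

theorem isUninformative_effect_zero {J : Type*} [DecidableEq J] {L E : J → Type*}
    [∀ j, Fintype (L j)] [∀ j, Fintype (E j)] [∀ j, DecidableEq (E j)] {K : ℕ}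
    (ρ : ∀ j, Matrix (L j) (L j) ℂ) :
    IsUninformative (E := E) ρ (effect (0 : (Σ j, L j × E j) × Fin K → ℂ)) 0 := fun j => by
  ext x x'
  simp [partialTraceLeft_apply, effect, Matrix.blockDiag', Matrix.mul_apply, Function.curry]

theorem isInjectionMarginal_blocks {J : Type*} [Fintype J] [DecidableEq J] {L E : J → Type*}
    [∀ j, Fintype (L j)] [∀ j, Fintype (E j)] {K : ℕ} (hK : 0 < K) {lam : ∀ j, L j → ℝ}
    (h_nonneg : ∀ j i, 0 ≤ lam j i) (h_sum : ∀ j, ∑ i, lam j i = 1)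
    (h_le : ∀ j i, lam j i * Fintype.card (E j) ≤ K) :
    IsInjectionMarginal fun (x : Σ j, E j) (i : Σ j, L j × Fin K) =>
      if x.1 = i.1 then lam i.1 i.2.1 / K else 0 where
  nonneg x i := by
    split_ifs
    · exact div_nonneg (h_nonneg _ _) K.cast_nonneg
    · exact le_rfl
  row_sum x := by
    have hK' : (K : ℝ) ≠ 0 := Nat.cast_ne_zero.2 hK.ne'
    simp only [Fintype.sum_sigma, Finset.sum_ite_irrel, Finset.sum_const_zero, Finset.sum_ite_eq,
      Finset.mem_univ, if_true, Fintype.sum_prod_type, Finset.sum_const, Finset.card_univ,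
      Fintype.card_fin, nsmul_eq_mul, mul_div_cancel₀ _ hK', h_sum]
  col_sum_le i := by
    have hK' : (0 : ℝ) < K := Nat.cast_pos.2 hK
    rw [Fintype.sum_sigma, Fintype.sum_eq_single i.1 fun j hj => by simp [hj]]
    simp only [if_true, Finset.sum_const, Finset.card_univ, nsmul_eq_mul]
    rw [← mul_div_assoc, div_le_one hK', mul_comm]
    exact h_le i.1 i.2.1

section Uninformative

variable {J : Type} [Fintype J] [DecidableEq J] {L E : J → Type} [∀ j, Fintype (L j)]
  [∀ j, Fintype (E j)] [∀ j, DecidableEq (L j)] [∀ j, DecidableEq (E j)]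

theorem blockDiag'_blockDiagonal'_mul {m n k : J → Type*} [∀ j, Fintype (n j)]
    (S : ∀ j, Matrix (m j) (n j) ℂ) (X : Matrix (Σ j, n j) (Σ j, k j) ℂ) (j : J) :
    Matrix.blockDiag' (Matrix.blockDiagonal' S * X) j = S j * Matrix.blockDiag' X j := by
  ext x x'
  simp only [Matrix.blockDiag'_apply, Matrix.mul_apply, Fintype.sum_sigma]
  rw [Fintype.sum_eq_single j fun j' hj' => by simp [Matrix.blockDiagonal'_apply_ne S _ _ hj'.symm]]
  simp

theorem blockDiag'_mul_blockDiagonal' {m n k : J → Type*} [∀ j, Fintype (n j)]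
    (X : Matrix (Σ j, m j) (Σ j, n j) ℂ) (S : ∀ j, Matrix (n j) (k j) ℂ) (j : J) :
    Matrix.blockDiag' (X * Matrix.blockDiagonal' S) j = Matrix.blockDiag' X j * S j := by
  ext x x'
  simp only [Matrix.blockDiag'_apply, Matrix.mul_apply, Fintype.sum_sigma]
  rw [Fintype.sum_eq_single j fun j' hj' => by simp [Matrix.blockDiagonal'_apply_ne S _ _ hj']]
  simp

theorem IsUninformative.conj {ρ : ∀ j, Matrix (L j) (L j) ℂ}
    {X : Matrix (Σ j, L j × E j) (Σ j, L j × E j) ℂ} {c : ℝ} (h : IsUninformative ρ X c)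
    {S : ∀ j, Matrix (L j) (L j) ℂ} (hS : ∀ j, (S j)ᴴ * S j = 1) :
    IsUninformative (fun j => S j * ρ j * (S j)ᴴ)
      (Matrix.blockDiagonal' (fun j => S j ⊗ₖ (1 : Matrix (E j) (E j) ℂ)) * X *
        (Matrix.blockDiagonal' fun j => S j ⊗ₖ (1 : Matrix (E j) (E j) ℂ))ᴴ) c := fun j => by
  have h_cancel : (S j ⊗ₖ (1 : Matrix (E j) (E j) ℂ))ᴴ * ((S j * ρ j * (S j)ᴴ) ⊗ₖ 1) =
      (ρ j ⊗ₖ 1) * ((S j)ᴴ ⊗ₖ 1) := by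
    rw [Matrix.conjTranspose_kronecker, ← Matrix.mul_kronecker_mul, ← Matrix.mul_kronecker_mul,
      Matrix.conjTranspose_one, ← Matrix.mul_assoc, ← Matrix.mul_assoc, hS, Matrix.one_mul]
  rw [Matrix.blockDiagonal'_conjTranspose, blockDiag'_mul_blockDiagonal',
    blockDiag'_blockDiagonal'_mul, Matrix.mul_assoc, h_cancel, Matrix.mul_assoc,
    ← partialTraceLeft_mul_kronecker_one_comm, Matrix.mul_assoc, Matrix.mul_assoc,
    ← Matrix.mul_kronecker_mul, Matrix.one_mul, hS, Matrix.one_kronecker_one, Matrix.mul_one, h j]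

theorem exists_uninformative_ensemble_of_diagonal {K : ℕ} (hK : 0 < K) {lam : ∀ j, L j → ℝ}
    (h_nonneg : ∀ j i, 0 ≤ lam j i) (h_sum : ∀ j, ∑ i, lam j i = 1)
    (h_le : ∀ j i, lam j i * Fintype.card (E j) ≤ K) :
    ∃ (Ω : Type) (_ : Fintype Ω) (u : Matrix ((Σ j, L j × E j) × Fin K) Ω ℂ) (c : Ω → ℝ),
      (∀ o, 0 ≤ c o) ∧ u * uᴴ = 1 ∧ ∀ o,
        IsUninformative (fun j => Matrix.diagonal fun i => (lam j i : ℂ)) (effect (u.col o))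
          (c o) := by
  obtain ⟨Ω, _, v, c, hc, hv, hvc⟩ :=
    (isInjectionMarginal_blocks hK h_nonneg h_sum h_le).exists_ensemble
  let f (y : (Σ j, L j × E j) × Fin K) : (Σ j, E j) × (Σ j, L j × Fin K) :=
    (⟨y.1.1, y.1.2.2⟩, ⟨y.1.1, y.1.2.1, y.2⟩)
  have hf : Function.Injective f := by
    rintro ⟨⟨j, i, x⟩, k⟩ ⟨⟨j', i', x'⟩, k'⟩ h
    simp only [f, Prod.mk_inj, Sigma.mk.injEq] at h
    obtain ⟨⟨rfl, hx⟩, -, hik⟩ := h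
    simp_all
  refine ⟨Ω, inferInstance, v.submatrix f id, c, hc, ?_, fun o j => ?_⟩
  · rw [Matrix.conjTranspose_submatrix, ← Matrix.submatrix_mul v vᴴ f id f Function.bijective_id,
      hv, Matrix.submatrix_one f hf]
  · ext x x'
    have h_weight := hvc o ⟨j, x⟩ ⟨j, x'⟩
    rw [Fintype.sum_sigma, Fintype.sum_eq_single j fun j' hj' => by simp [hj'.symm]] at h_weight
    simp only [if_true, Fintype.sum_prod_type, Sigma.mk.injEq, true_and, heq_eq_eq] at h_weight
    rw [Matrix.smul_apply, Matrix.one_apply, smul_eq_mul, mul_ite, mul_one, mul_zero, ← h_weight,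
      partialTraceLeft_mul_diagonal_kronecker_one_apply]
    refine Finset.sum_congr rfl fun i _ => ?_
    have h_sqrt : (√(lam j i / K) : ℂ) * √(lam j i / K) = (K : ℂ)⁻¹ * lam j i := by
      rw [← Complex.ofReal_mul, Real.mul_self_sqrt (div_nonneg (h_nonneg j i) K.cast_nonneg)]
      push_cast
      ring
    rw [Matrix.blockDiag'_apply, effect_apply, Finset.mul_sum, Finset.sum_mul]
    refine Finset.sum_congr rfl fun k _ => ?_
    simp only [Matrix.col_apply, Matrix.submatrix_apply, id, star_mul', f]
    rw [Complex.star_def, Complex.conj_ofReal, ← Complex.star_def]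
    linear_combination (-(v (⟨j, x⟩, ⟨j, i, k⟩) o * star (v (⟨j, x'⟩, ⟨j, i, k⟩) o))) * h_sqrt

theorem exists_uninformative_ensemble {K : ℕ} (hK : 0 < K) {ρ : ∀ j, Matrix (L j) (L j) ℂ}
    (hρ : ∀ j, (ρ j).PosSemidef) (h_trace : ∀ j, (ρ j).trace = 1)
    (h_le : ∀ j i, (hρ j).isHermitian.eigenvalues i * Fintype.card (E j) ≤ K) :
    ∃ (Ω : Type) (_ : Fintype Ω) (u : Matrix ((Σ j, L j × E j) × Fin K) Ω ℂ) (c : Ω → ℝ),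
      (∀ o, 0 ≤ c o) ∧ u * uᴴ = 1 ∧ ∀ o, IsUninformative ρ (effect (u.col o)) (c o) := by
  have h_sum : ∀ j, ∑ i, (hρ j).isHermitian.eigenvalues i = 1 := fun j => by
    apply Complex.ofReal_injective
    rw [Complex.ofReal_sum, Complex.ofReal_one, ← h_trace j]
    exact (hρ j).isHermitian.trace_eq_sum_eigenvalues.symm
  obtain ⟨Ω, _, u, c, hc, hu, huc⟩ := exists_uninformative_ensemble_of_diagonal hK
    (fun j => (hρ j).eigenvalues_nonneg) h_sum h_le
  let S (j : J) : Matrix (L j) (L j) ℂ := (hρ j).isHermitian.eigenvectorUnitary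
  have hS : ∀ j, (S j)ᴴ * S j = 1 := fun j =>
    Unitary.coe_star_mul_self (hρ j).isHermitian.eigenvectorUnitary
  have h_spectral : ∀ j, ρ j =
      S j * Matrix.diagonal (fun i => ((hρ j).isHermitian.eigenvalues i : ℂ)) * (S j)ᴴ := fun j =>
    (hρ j).isHermitian.spectral_theorem
  let F : Matrix (Σ j, L j × E j) (Σ j, L j × E j) ℂ :=
    Matrix.blockDiagonal' fun j => S j ⊗ₖ (1 : Matrix (E j) (E j) ℂ)
  have hF : F * Fᴴ = 1 := by
    have hS' : ∀ j, S j * (S j)ᴴ = 1 := fun j =>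
      Unitary.coe_mul_star_self (hρ j).isHermitian.eigenvectorUnitary
    simp only [F, Matrix.blockDiagonal'_conjTranspose, ← Matrix.blockDiagonal'_mul,
      Matrix.conjTranspose_kronecker, ← Matrix.mul_kronecker_mul, hS', Matrix.conjTranspose_one,
      Matrix.mul_one, Matrix.one_kronecker_one]
    exact Matrix.blockDiagonal'_one
  refine ⟨Ω, inferInstance, (F ⊗ₖ (1 : Matrix (Fin K) (Fin K) ℂ)) * u, c, hc, ?_, fun o => ?_⟩
  · rw [Matrix.conjTranspose_mul, Matrix.mul_assoc, ← Matrix.mul_assoc u, hu, Matrix.one_mul,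
      Matrix.conjTranspose_kronecker, ← Matrix.mul_kronecker_mul, hF, Matrix.conjTranspose_one,
      Matrix.one_mul, Matrix.one_kronecker_one]
  · have h_col : ((F ⊗ₖ (1 : Matrix (Fin K) (Fin K) ℂ)) * u).col o = (F ⊗ₖ 1) *ᵥ u.col o := rfl
    rw [h_col, effect_kronecker_one_mulVec, funext h_spectral]
    exact (huc o).conj hS

end Uninformative

/-! ### Exact state merging -/

section Measurement

theorem sum_vecMulVec_col {Y Ω : Type*} [Fintype Ω] (u : Matrix Y Ω ℂ) :
    ∑ o, Matrix.vecMulVec (u.col o) (star (u.col o)) = u * uᴴ := by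
  ext y y'
  simp only [Matrix.sum_apply, Matrix.vecMulVec_apply, Matrix.mul_apply,
    Matrix.conjTranspose_apply, Matrix.col_apply, Pi.star_apply]

theorem fromCols_mul_conjTranspose_eq_one {X Y Ω : Type*} [Fintype X] [DecidableEq X] [Fintype Y]
    [DecidableEq Y] [Fintype Ω] {F : Matrix Y X ℂ} (hF : Fᴴ * F = 1) {u : Matrix X Ω ℂ}
    (hu : u * uᴴ = 1) :
    Matrix.fromCols (F * u) (1 - F * Fᴴ) * (Matrix.fromCols (F * u) (1 - F * Fᴴ))ᴴ = 1 := by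
  have h_range : F * u * (F * u)ᴴ = F * Fᴴ := by
    rw [Matrix.conjTranspose_mul, Matrix.mul_assoc, ← Matrix.mul_assoc u, hu, Matrix.one_mul]
  have h_proj : F * Fᴴ * (F * Fᴴ) = F * Fᴴ := by
    rw [Matrix.mul_assoc, ← Matrix.mul_assoc Fᴴ, hF, Matrix.one_mul]
  have h_compl : (1 - F * Fᴴ) * (1 - F * Fᴴ)ᴴ = 1 - F * Fᴴ := by
    rw [Matrix.conjTranspose_sub, Matrix.conjTranspose_one, Matrix.conjTranspose_mul,
      Matrix.conjTranspose_conjTranspose, Matrix.mul_sub, Matrix.mul_one, Matrix.sub_mul,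
      Matrix.one_mul, h_proj, sub_self, sub_zero]
  rw [Matrix.conjTranspose_fromCols_eq_fromRows_conjTranspose, Matrix.fromCols_mul_fromRows,
    h_range, h_compl, add_sub_cancel]

theorem conjTranspose_mul_fromCols {X Y Ω : Type*} [Fintype X] [DecidableEq X] [Fintype Y]
    [DecidableEq Y] {F : Matrix Y X ℂ} (hF : Fᴴ * F = 1) (u : Matrix X Ω ℂ) :
    Fᴴ * Matrix.fromCols (F * u) (1 - F * Fᴴ) = Matrix.fromCols u 0 := by
  rw [Matrix.mul_fromCols, ← Matrix.mul_assoc, hF, Matrix.one_mul, Matrix.mul_sub,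
    Matrix.mul_one, ← Matrix.mul_assoc, hF, Matrix.one_mul, sub_self]

theorem measured_apply {R A B : Type} [Fintype A] {K : ℕ} (ψ : R → A → B → ℂ)
    (m : A × Fin K → ℂ) (r : R) (b : B) (k : Fin K) :
    measured ψ m r (b, k) = (1 / √K : ℝ) * ∑ a, star (m (a, k)) * ψ r a b := by
  simp only [measured, maxEnt, mul_ite, mul_zero, Finset.sum_ite_eq', Finset.mem_univ, if_true,
    Finset.mul_sum]
  exact Finset.sum_congr rfl fun a _ => by ring

variable {R A B : Type} [Fintype A] [Fintype B]

theorem gram_uncurry_apply (ψ : R → A → B → ℂ) (r r' : R) :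
    gram (fun r => Function.uncurry (ψ r)) r r' =
      ((Matrix.of (ψ r))ᴴ * Matrix.of (ψ r')).trace := by
  simp only [gram_apply, Fintype.sum_prod_type, Matrix.trace, Matrix.diag_apply, Matrix.mul_apply,
    Matrix.conjTranspose_apply, Matrix.of_apply, Function.uncurry]
  exact Finset.sum_comm

theorem gram_measured_apply {K : ℕ} (ψ : R → A → B → ℂ) (m : A × Fin K → ℂ) (r r' : R) :
    gram (measured ψ m) r r' =
      ((Matrix.of (ψ r))ᴴ * effect m * Matrix.of (ψ r')).trace := by
  have h_matrix : ∀ r b k, measured ψ m r (b, k) = (1 / √K : ℝ) *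
      ((Matrix.of (Function.curry m))ᴴ * Matrix.of (ψ r)) k b := measured_apply ψ m
  have h_norm : ((1 / √K : ℝ) : ℂ) * (1 / √K : ℝ) = (K : ℂ)⁻¹ := by
    rw [← Complex.ofReal_mul, ← sq, div_pow, Real.sq_sqrt K.cast_nonneg]
    push_cast
    ring
  have h_trace : ((Matrix.of (ψ r))ᴴ * effect m * Matrix.of (ψ r')).trace =
      (K : ℂ)⁻¹ * (((Matrix.of (Function.curry m))ᴴ * Matrix.of (ψ r))ᴴ *
        ((Matrix.of (Function.curry m))ᴴ * Matrix.of (ψ r'))).trace := by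
    simp only [effect, Matrix.mul_smul, Matrix.smul_mul, Matrix.trace_smul, smul_eq_mul,
      Matrix.conjTranspose_mul, Matrix.conjTranspose_conjTranspose, Matrix.mul_assoc]
  rw [h_trace, gram_apply, Fintype.sum_prod_type, Matrix.trace, Finset.mul_sum]
  refine Finset.sum_congr rfl fun b _ => ?_
  rw [Matrix.diag_apply, Matrix.mul_apply, Finset.mul_sum]
  refine Finset.sum_congr rfl fun k _ => ?_
  rw [h_matrix, h_matrix, star_mul', Complex.star_def, Complex.conj_ofReal,
    Matrix.conjTranspose_apply, ← h_norm, Complex.star_def]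
  ring

theorem sum_gram_measured [DecidableEq A] {K : ℕ} (hK : 0 < K) (ψ : R → A → B → ℂ) {Ω : Type*}
    [Fintype Ω] {m : Ω → A × Fin K → ℂ} (hm : ∑ o, Matrix.vecMulVec (m o) (star (m o)) = 1) :
    ∑ o, gram (measured ψ (m o)) = gram fun r => Function.uncurry (ψ r) := by
  ext r r'
  simp only [Matrix.sum_apply, gram_measured_apply, ← Matrix.trace_sum, ← Matrix.sum_mul,
    ← Matrix.mul_sum, gram_uncurry_apply]
  rw [sum_effect hK hm, Matrix.mul_one]

theorem IsExactMerging.exists_gram_measured {K n : ℕ} {ψ : R → A → B → ℂ}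
    {m : Fin n → A × Fin K → ℂ} (h : IsExactMerging ψ m) (o : Fin n) :
    ∃ t : ℝ, 0 ≤ t ∧
      gram (measured ψ (m o)) = (t : ℂ) • gram fun r => Function.uncurry (ψ r) := by
  classical
  obtain ⟨d, W, χ, hW, hWψ⟩ := h.2 o
  refine ⟨∑ i, ‖χ i‖ ^ 2, by positivity, ?_⟩
  rw [← gram_mulVec hW]
  ext r r'
  have h_product : ∀ r y, (W *ᵥ measured ψ (m o) r) y = χ y.2 * ψ r y.1.1 y.1.2 :=
    fun r y => hWψ r y.1.1 y.1.2 y.2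
  simp only [Matrix.smul_apply, gram_apply, h_product, Fintype.sum_prod_type, Function.uncurry,
    smul_eq_mul, Finset.mul_sum, star_mul']
  refine Finset.sum_congr rfl fun a _ => Finset.sum_congr rfl fun b _ => ?_
  rw [Complex.ofReal_sum, Finset.sum_mul]
  refine Finset.sum_congr rfl fun i _ => ?_
  rw [Complex.ofReal_pow, ← Complex.conj_mul', Complex.star_def]
  ring

theorem exists_merging_isometry {K : ℕ} (hK : 0 < K) [Nonempty A] [DecidableEq B]
    {ψ : R → A → B → ℂ} {m : A × Fin K → ℂ} {c : ℝ} (hc : 0 ≤ c)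
    (h : gram (measured ψ m) = (c : ℂ) • gram fun r => Function.uncurry (ψ r)) :
    ∃ (W : Matrix ((A × B) × Fin K) (B × Fin K) ℂ) (χ : Fin K → ℂ), Wᴴ * W = 1 ∧
      ∀ r a b i, ∑ y, W ((a, b), i) y * measured ψ m r y = χ i * ψ r a b := by
  let χ : Fin K → ℂ := Pi.single ⟨0, hK⟩ (√c : ℂ)
  have hχ : ∑ i, star (χ i) * χ i = c := by
    rw [Fintype.sum_eq_single ⟨0, hK⟩ fun i hi => by simp [χ, hi]]
    simp only [χ, Pi.single_eq_same, Complex.star_def, Complex.conj_ofReal, ← Complex.ofReal_mul,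
      Real.mul_self_sqrt hc]
  have h_gram : gram (measured ψ m) =
      gram fun r (y : (A × B) × Fin K) => χ y.2 * ψ r y.1.1 y.1.2 := by
    rw [h]
    ext r r'
    simp only [Matrix.smul_apply, gram_apply, smul_eq_mul, ← hχ, Finset.sum_mul_sum,
      Fintype.sum_prod_type_right (fun _ : (A × B) × Fin K => _), Function.uncurry]
    exact Finset.sum_congr rfl fun i _ => Finset.sum_congr rfl fun _ _ => by
      rw [star_mul']
      ring
  have h_card : Fintype.card (B × Fin K) ≤ Fintype.card ((A × B) × Fin K) := by
    simp only [Fintype.card_prod]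
    gcongr
    exact Nat.le_mul_of_pos_left _ Fintype.card_pos
  obtain ⟨W, hW, hWψ⟩ := exists_isometry_of_gram_eq h_card h_gram
  exact ⟨W, χ, hW, fun r a b i => congr_fun (hWψ r) ((a, b), i)⟩

end Measurement

namespace KoashiImotoDecomposition

variable {R A B : Type} [Fintype R] [Fintype A] [Fintype B] {ψ : R → A → B → ℂ}

theorem of_eq_embA_mul_blockDiagonal'_mul (δ : KoashiImotoDecomposition ψ) (r : R) :
    Matrix.of (ψ r) = δ.embA * Matrix.blockDiagonal'
      (fun j => (√(δ.p j) : ℂ) • (δ.ω j ⊗ₖ Matrix.of (δ.φ j r))) * δ.embBᵀ := by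
  ext a b
  have h_row : ∀ j y, (δ.embA * Matrix.blockDiagonal'
      (fun j => (√(δ.p j) : ℂ) • (δ.ω j ⊗ₖ Matrix.of (δ.φ j r)))) a ⟨j, y⟩ =
        ∑ x : Fin (δ.aL j) × Fin (δ.aR j),
          δ.embA a ⟨j, x⟩ * (√(δ.p j) * (δ.ω j x.1 y.1 * δ.φ j r x.2 y.2)) := fun j y => by
    rw [Matrix.mul_apply, Fintype.sum_sigma,
      Fintype.sum_eq_single j fun j' hj' => by simp [Matrix.blockDiagonal'_apply_ne _ _ _ hj']]
    simp only [Matrix.blockDiagonal'_apply_eq, Matrix.smul_apply, smul_eq_mul,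
      Matrix.kroneckerMap_apply, Matrix.of_apply]
  rw [Matrix.of_apply, δ.decomp, Matrix.mul_apply, Fintype.sum_sigma]
  refine Finset.sum_congr rfl fun j _ => ?_
  simp only [h_row, Finset.mul_sum, Finset.sum_mul, Matrix.transpose_apply]
  rw [Finset.sum_comm]
  exact Finset.sum_congr rfl fun y _ => Finset.sum_congr rfl fun x _ => by ring

theorem trace_reduced (δ : KoashiImotoDecomposition ψ) (j : Fin δ.J) :
    (δ.ω j * (δ.ω j)ᴴ).trace = 1 := by
  rw [← Complex.ofReal_one, ← δ.ω_unit j]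
  simp [Matrix.trace, Matrix.mul_apply, Complex.mul_conj']

theorem trace_conj_of_isUninformative (δ : KoashiImotoDecomposition ψ) {X : Matrix A A ℂ} {c : ℝ}
    (h : IsUninformative (fun j => δ.ω j * (δ.ω j)ᴴ) (δ.embAᴴ * X * δ.embA) c) (r r' : R) :
    ((Matrix.of (ψ r))ᴴ * X * Matrix.of (ψ r')).trace =
      c * ∑ j, δ.p j * (Matrix.of (δ.φ j r') * (Matrix.of (δ.φ j r))ᴴ).trace := by
  let Δ (r : R) := Matrix.blockDiagonal'
      (fun j => (√(δ.p j) : ℂ) • (δ.ω j ⊗ₖ Matrix.of (δ.φ j r)))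
  have h_embB : δ.embBᵀ * (δ.embBᵀ)ᴴ = 1 := by
    have := congrArg Matrix.transpose δ.embB_isometry
    rwa [Matrix.transpose_mul, Matrix.transpose_one] at this
  have h_blocks : Δ r' * (Δ r)ᴴ = Matrix.blockDiagonal' fun j => (δ.p j : ℂ) •
      (((δ.ω j * (δ.ω j)ᴴ) ⊗ₖ 1) * (1 ⊗ₖ (Matrix.of (δ.φ j r') * (Matrix.of (δ.φ j r))ᴴ))) := by
    rw [Matrix.blockDiagonal'_conjTranspose, ← Matrix.blockDiagonal'_mul]
    congr 1
    funext j
    rw [Matrix.conjTranspose_smul, Matrix.conjTranspose_kronecker, Matrix.smul_mul,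
      Matrix.mul_smul, smul_smul, ← Matrix.mul_kronecker_mul, ← Matrix.mul_kronecker_mul,
      Matrix.mul_one, Matrix.one_mul, Complex.star_def, Complex.conj_ofReal, ← Complex.ofReal_mul,
      Real.mul_self_sqrt (δ.p_nonneg j)]
  have h_conj : (Matrix.of (ψ r))ᴴ * X * Matrix.of (ψ r') =
      (δ.embBᵀ)ᴴ * ((Δ r)ᴴ * (δ.embAᴴ * X * δ.embA * Δ r')) * δ.embBᵀ := by
    rw [δ.of_eq_embA_mul_blockDiagonal'_mul r, δ.of_eq_embA_mul_blockDiagonal'_mul r']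
    simp only [Δ, Matrix.conjTranspose_mul, Matrix.mul_assoc]
  calc ((Matrix.of (ψ r))ᴴ * X * Matrix.of (ψ r')).trace
      = (δ.embAᴴ * X * δ.embA * (Δ r' * (Δ r)ᴴ)).trace := by
        rw [h_conj, Matrix.trace_mul_cycle, h_embB, Matrix.one_mul, Matrix.trace_mul_comm,
          Matrix.mul_assoc]
    _ = _ := by
        rw [h_blocks, trace_eq_sum_trace_blockDiag', Finset.mul_sum]
        refine Finset.sum_congr rfl fun j _ => ?_
        rw [blockDiag'_mul_blockDiagonal', Matrix.mul_smul, Matrix.trace_smul, ← Matrix.mul_assoc,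
          trace_mul_one_kronecker, h j, Matrix.smul_mul, Matrix.one_mul, Matrix.trace_smul,
          smul_eq_mul, smul_eq_mul, mul_left_comm]

theorem isUninformative_one [DecidableEq A] (δ : KoashiImotoDecomposition ψ) :
    IsUninformative (fun j => δ.ω j * (δ.ω j)ᴴ) (δ.embAᴴ * (1 : Matrix A A ℂ) * δ.embA) 1 :=
  fun j => by
    rw [Matrix.mul_one, δ.embA_isometry, Matrix.blockDiag'_one, Pi.one_apply, Matrix.one_mul,
      partialTraceLeft_kronecker_one, δ.trace_reduced, Complex.ofReal_one]

theorem gram_measured_of_isUninformative (δ : KoashiImotoDecomposition ψ) {K : ℕ}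
    {m : A × Fin K → ℂ} {c : ℝ}
    (h : IsUninformative (fun j => δ.ω j * (δ.ω j)ᴴ) (δ.embAᴴ * effect m * δ.embA) c) :
    gram (measured ψ m) = (c : ℂ) • gram fun r => Function.uncurry (ψ r) := by
  classical
  ext r r'
  rw [gram_measured_apply, δ.trace_conj_of_isUninformative h, Matrix.smul_apply, gram_uncurry_apply,
    ← Matrix.mul_one (Matrix.of (ψ r))ᴴ, δ.trace_conj_of_isUninformative δ.isUninformative_one,
    Complex.ofReal_one, one_mul, smul_eq_mul]

theorem nonempty_left (δ : KoashiImotoDecomposition ψ) : Nonempty A := by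
  obtain ⟨j⟩ : Nonempty (Fin δ.J) := by
    by_contra h_empty
    rw [not_nonempty_iff] at h_empty
    simpa using δ.p_sum
  obtain ⟨i⟩ : Nonempty (Fin (δ.aL j)) := by
    by_contra h_empty
    rw [not_nonempty_iff] at h_empty
    simpa using δ.ω_unit j
  obtain ⟨x⟩ : Nonempty (Fin (δ.aR j)) := by
    by_contra h_empty
    rw [not_nonempty_iff] at h_empty
    simpa using δ.φ_unit j
  by_contra h_empty
  rw [not_nonempty_iff] at h_empty
  simpa [Matrix.mul_apply] using congr_fun₂ δ.embA_isometry ⟨j, i, x⟩ ⟨j, i, x⟩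

theorem CostAtMost.eigenvalue_mul_le {δ : KoashiImotoDecomposition ψ} {K : ℕ} (hK : 0 < K)
    (h : δ.CostAtMost K) (j : Fin δ.J) (i : Fin (δ.aL j)) :
    (Matrix.isHermitian_mul_conjTranspose_self (δ.ω j)).eigenvalues i * δ.aR j ≤ K := by
  have h_max : (Matrix.isHermitian_mul_conjTranspose_self (δ.ω j)).eigenvalues i ≤
      δ.maxEigenvalue j :=
    le_ciSup (Set.finite_range (Matrix.isHermitian_mul_conjTranspose_self (δ.ω j)).eigenvalues
      ).bddAbove i
  have h_ceil : ⌈δ.maxEigenvalue j * (δ.aR j : ℝ)⌉₊ ≤ K := by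
    rcases Nat.eq_zero_or_pos ⌈δ.maxEigenvalue j * (δ.aR j : ℝ)⌉₊ with h_zero | h_pos
    · exact h_zero ▸ K.zero_le
    · exact_mod_cast (Real.logb_le_logb one_lt_two (Nat.cast_pos.2 h_pos) (Nat.cast_pos.2 hK)).1
        (h j)
  calc _ ≤ δ.maxEigenvalue j * δ.aR j := by gcongr
    _ ≤ K := Nat.ceil_le.1 h_ceil

theorem exists_uninformative_measurement (δ : KoashiImotoDecomposition ψ) [DecidableEq A] {K : ℕ}
    (hK : 0 < K) (h : δ.CostAtMost K) :
    ∃ (n : ℕ) (m : Fin n → A × Fin K → ℂ) (c : Fin n → ℝ),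
      (∑ o, Matrix.vecMulVec (m o) (star (m o)) = 1) ∧ (∀ o, 0 ≤ c o) ∧
      ∀ o, IsUninformative (fun j => δ.ω j * (δ.ω j)ᴴ) (δ.embAᴴ * effect (m o) * δ.embA) (c o) := by
  obtain ⟨Ω, _, u, c, hc, hu, huc⟩ := exists_uninformative_ensemble hK
    (fun j => Matrix.posSemidef_self_mul_conjTranspose (δ.ω j)) δ.trace_reduced
    (fun j i => by rw [Fintype.card_fin]; exact h.eigenvalue_mul_le hK j i)
  let F : Matrix (A × Fin K) (_ × Fin K) ℂ := δ.embA ⊗ₖ (1 : Matrix (Fin K) (Fin K) ℂ)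
  have hF : Fᴴ * F = 1 := by
    rw [Matrix.conjTranspose_kronecker, ← Matrix.mul_kronecker_mul, δ.embA_isometry,
      Matrix.conjTranspose_one, Matrix.one_mul, Matrix.one_kronecker_one]
  let v := Matrix.fromCols (F * u) (1 - F * Fᴴ)
  have h_col : ∀ o, Fᴴ *ᵥ v.col o = (Matrix.fromCols u 0).col o := fun o =>
    congrArg (fun w => w.col o) (conjTranspose_mul_fromCols hF u)
  have h_effect : ∀ o, δ.embAᴴ * effect (v.col o) * δ.embA =
      effect ((Matrix.fromCols u 0).col o) := fun o => by
    rw [← h_col, Matrix.conjTranspose_kronecker, Matrix.conjTranspose_one,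
      effect_kronecker_one_mulVec, Matrix.conjTranspose_conjTranspose]
  have h_nonneg : ∀ o : Ω ⊕ A × Fin K, 0 ≤ Sum.elim c 0 o := by
    rintro (o | _)
    exacts [hc o, le_rfl]
  have h_uninformative : ∀ o, IsUninformative (fun j => δ.ω j * (δ.ω j)ᴴ)
      (δ.embAᴴ * effect (v.col o) * δ.embA) (Sum.elim c 0 o) := fun o => by
    rw [h_effect]
    rcases o with o | _
    exacts [huc o, isUninformative_effect_zero _]
  let e := (Fintype.equivFin (Ω ⊕ A × Fin K)).symm
  refine ⟨_, fun o => v.col (e o), fun o => Sum.elim c 0 (e o), ?_, fun o => h_nonneg (e o),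
    fun o => h_uninformative (e o)⟩
  rw [e.sum_comp fun o => Matrix.vecMulVec (v.col o) (star (v.col o)), sum_vecMulVec_col,
    fromCols_mul_conjTranspose_eq_one hF hu]

theorem exists_isExactMerging (δ : KoashiImotoDecomposition ψ) {K : ℕ} (hK : 0 < K)
    (h : δ.CostAtMost K) : ∃ (n : ℕ) (m : Fin n → A × Fin K → ℂ), IsExactMerging ψ m := by
  classical
  obtain ⟨n, m, c, hm, hc, hmc⟩ := δ.exists_uninformative_measurement hK h
  have := δ.nonempty_left
  refine ⟨n, m, ?_, fun o => ⟨K, ?_⟩⟩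
  · convert hm
  · convert exists_merging_isometry hK (hc o) (δ.gram_measured_of_isUninformative (hmc o))

end KoashiImotoDecomposition

/-! ### Encodings recoverable by LOCC -/

theorem IsLOCC.map_smul {V : Type} [Fintype V] [DecidableEq V] {ι κ : V → Type}
    {C : Matrix (∀ v, ι v) (∀ v, ι v) ℂ → Matrix (∀ v, κ v) (∀ v, κ v) ℂ} (hC : IsLOCC C)
    (c : ℂ) (ρ : Matrix (∀ v, ι v) (∀ v, ι v) ℂ) : C (c • ρ) = c • C ρ := by
  induction hC with
  | id => rfl
  | round _ _ _ _ _ _ ih =>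
    simp only [Matrix.mul_smul, Matrix.smul_mul, ih, Finset.smul_sum]

section Recoverable

variable {V : Type} [DecidableEq V] {r : V} {D : ℕ} {ι ι' : V → Type}

theorem sum_vecMulVec_comp_equiv {O X Y : Type} [Fintype O] [DecidableEq X] [DecidableEq Y]
    (F : X ≃ Y) {m : O → Y → ℂ} (hm : ∑ o, Matrix.vecMulVec (m o) (star (m o)) = 1) :
    ∑ o, Matrix.vecMulVec (m o ∘ F) (star (m o ∘ F)) = 1 := by
  have hsub : ∀ o, Matrix.vecMulVec (m o ∘ F) (star (m o ∘ F)) =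
      (Matrix.vecMulVec (m o) (star (m o))).submatrix F F := fun _ => rfl
  rw [← Matrix.submatrix_one_equiv F, ← hm]
  ext
  simp only [hsub, Matrix.sum_apply, Matrix.submatrix_apply]

/-- The joint label in which `v` has label `a` and every other party has the label it had before
the relabelling `e`. -/
def insertLabel (v : V) (e : ∀ w, w ≠ v → ι w ≃ ι' w) (a : ι v) (y : ∀ w, ι' w) : ∀ w, ι w :=
  fun w => if h : w = v then h ▸ a else (e w h).symm (y w)

theorem insertLabel_self (v : V) (e : ∀ w, w ≠ v → ι w ≃ ι' w) (a : ι v) (y : ∀ w, ι' w) :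
    insertLabel v e a y v = a := dif_pos rfl

theorem insertLabel_of_ne {v w : V} (h : w ≠ v) (e : ∀ w, w ≠ v → ι w ≃ ι' w) (a : ι v)
    (y : ∀ w, ι' w) : insertLabel v e a y w = (e w h).symm (y w) := dif_neg h

section LocalKraus

variable [∀ v, DecidableEq (ι v)]

/-- The local operators of a round in which `v` applies `B` and every other party relabels its
basis by `e`. -/
def localKraus (v : V) (e : ∀ w, w ≠ v → ι w ≃ ι' w) (B : Matrix (ι' v) (ι v) ℂ) (w : V) :
    Matrix (ι' w) (ι w) ℂ :=
  if h : w = v then h ▸ B else (1 : Matrix (ι w) (ι w) ℂ).submatrix (e w h).symm id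

theorem localKraus_self (v : V) (e : ∀ w, w ≠ v → ι w ≃ ι' w) (B : Matrix (ι' v) (ι v) ℂ) :
    localKraus v e B v = B := dif_pos rfl

theorem localKraus_of_ne {v w : V} (h : w ≠ v) (e : ∀ w, w ≠ v → ι w ≃ ι' w)
    (B : Matrix (ι' v) (ι v) ℂ) :
    localKraus v e B w = (1 : Matrix (ι w) (ι w) ℂ).submatrix (e w h).symm id := dif_neg h

theorem conjTranspose_localKraus_mul_self_of_ne {v w : V} [Fintype (ι' w)] (h : w ≠ v)
    (e : ∀ w, w ≠ v → ι w ≃ ι' w) (B : Matrix (ι' v) (ι v) ℂ) :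
    (localKraus v e B w)ᴴ * localKraus v e B w = 1 := by
  have : Fintype (ι w) := .ofEquiv _ (e w h).symm
  rw [localKraus_of_ne h, Matrix.conjTranspose_submatrix, Matrix.submatrix_mul_equiv]
  simp

end LocalKraus

variable [Fintype V]

/-- Some LOCC map undoes the encoding `ρ ↦ Θ ρ Θ†` of `ℂ^D` into the joint system of the parties,
leaving `ρ` at the party `r`. -/
def IsRecoverable (r : V) (Θ : Matrix (∀ v, ι v) (Fin D) ℂ) : Prop :=
  ∃ C : Matrix (∀ v, ι v) (∀ v, ι v) ℂ →
      Matrix (∀ v, FinalSystem r D v) (∀ v, FinalSystem r D v) ℂ,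
    IsLOCC C ∧ ∀ ρ : Matrix (Fin D) (Fin D) ℂ, C (Θ * ρ * Θᴴ) = finalState r ρ

theorem isRecoverable_final :
    IsRecoverable r (Matrix.of fun (y : ∀ v, FinalSystem r D v) l =>
      (1 : Matrix (Fin D) (Fin D) ℂ) (y r rfl) l) := by
  refine ⟨_, IsLOCC.id, fun ρ => ?_⟩
  ext y y'
  simp [Matrix.mul_apply, Matrix.one_apply, finalState]

variable [∀ v, Fintype (ι v)]

theorem IsRecoverable.of_round [∀ v, DecidableEq (ι v)] [∀ v, Fintype (ι' v)] (v : V)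
    {O : Type} [Fintype O]
    (A : O → ∀ w, Matrix (ι' w) (ι w) ℂ) (hv : ∑ o, (A o v)ᴴ * A o v = 1)
    (hw : ∀ o w, w ≠ v → (A o w)ᴴ * A o w = 1) {Θ : Matrix (∀ w, ι w) (Fin D) ℂ}
    {Θ' : O → Matrix (∀ w, ι' w) (Fin D) ℂ} {α : O → ℂ} (hα : ∑ o, ‖α o‖ ^ 2 = 1)
    (hΘ : ∀ o, localOp (A o) * Θ = α o • Θ' o)
    (hΘ' : ∀ o, α o ≠ 0 → IsRecoverable r (Θ' o)) : IsRecoverable r Θ := by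
  obtain ⟨o₀, -, h₀⟩ := Finset.exists_ne_zero_of_sum_ne_zero (hα.trans_ne one_ne_zero)
  obtain ⟨C₀, hC₀, -⟩ := hΘ' o₀ fun h => h₀ (by simp [h])
  have hnext : ∀ o, ∃ C : Matrix (∀ w, ι' w) (∀ w, ι' w) ℂ →
      Matrix (∀ w, FinalSystem r D w) (∀ w, FinalSystem r D w) ℂ,
      IsLOCC C ∧ (α o ≠ 0 → ∀ ρ, C (Θ' o * ρ * (Θ' o)ᴴ) = finalState r ρ) := by
    intro o
    by_cases h : α o = 0
    · exact ⟨C₀, hC₀, fun h' => absurd h h'⟩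
    · obtain ⟨C, hC, hCΘ⟩ := hΘ' o h
      exact ⟨C, hC, fun _ => hCΘ⟩
  choose next hLOCC hrec using hnext
  refine ⟨_, IsLOCC.round v A hv hw next hLOCC, fun ρ => ?_⟩
  have hbranch : ∀ o, next o (localOp (A o) * (Θ * ρ * Θᴴ) * (localOp (A o))ᴴ) =
      ((‖α o‖ ^ 2 : ℝ) : ℂ) • finalState r ρ := by
    intro o
    have hencode : localOp (A o) * (Θ * ρ * Θᴴ) * (localOp (A o))ᴴ =
        ((‖α o‖ ^ 2 : ℝ) : ℂ) • (Θ' o * ρ * (Θ' o)ᴴ) := by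
      calc localOp (A o) * (Θ * ρ * Θᴴ) * (localOp (A o))ᴴ
          = (localOp (A o) * Θ) * ρ * (localOp (A o) * Θ)ᴴ := by
            simp only [Matrix.conjTranspose_mul, Matrix.mul_assoc]
        _ = ((‖α o‖ ^ 2 : ℝ) : ℂ) • (Θ' o * ρ * (Θ' o)ᴴ) := by
            simp only [hΘ, Matrix.conjTranspose_smul, Matrix.smul_mul, Matrix.mul_smul, smul_smul,
              Complex.star_def, Complex.conj_mul', Complex.ofReal_pow]
    rw [hencode, (hLOCC o).map_smul]
    by_cases h : α o = 0
    · simp [h]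
    · rw [hrec o h]
  rw [Finset.sum_congr rfl fun o _ => hbranch o, ← Finset.sum_smul, ← Complex.ofReal_sum, hα,
    Complex.ofReal_one, one_smul]

theorem localOp_localKraus_mul_apply [∀ v, DecidableEq (ι v)] (v : V)
    (e : ∀ w, w ≠ v → ι w ≃ ι' w)
    (B : Matrix (ι' v) (ι v) ℂ) (Θ : Matrix (∀ w, ι w) (Fin D) ℂ) (y : ∀ w, ι' w) (l : Fin D) :
    (localOp (localKraus v e B) * Θ) y l =
      ∑ a, B (y v) a * Θ (insertLabel v e a y) l := by
  have hprod : ∀ a, localOp (localKraus v e B) y (insertLabel v e a y) = B (y v) a := by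
    intro a
    rw [localOp, Finset.prod_eq_single v _ (by simp), localKraus_self, insertLabel_self]
    intro w _ hw
    rw [localKraus_of_ne hw, insertLabel_of_ne hw]
    exact Matrix.one_apply_eq _
  refine (Fintype.sum_of_injective (insertLabel v e · y) ?_ _ _ (fun x hx => ?_) fun a => ?_).symm
  · intro a a' h
    simpa only [insertLabel_self] using congrFun h v
  · obtain ⟨w, hw⟩ : ∃ w, insertLabel v e (x v) y w ≠ x w :=
      Function.ne_iff.1 fun h => hx ⟨x v, h⟩
    have hwv : w ≠ v := by
      rintro rfl
      exact hw (insertLabel_self ..)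
    have hzero : localOp (localKraus v e B) y x = 0 := by
      refine Finset.prod_eq_zero (Finset.mem_univ w) ?_
      rw [localKraus_of_ne hwv]
      exact Matrix.one_apply_ne (by rwa [insertLabel_of_ne hwv] at hw)
    exact mul_eq_zero_of_left hzero _
  · exact congrArg (· * Θ _ l) (hprod a).symm

theorem IsRecoverable.of_kraus [∀ v, DecidableEq (ι v)] [∀ v, Fintype (ι' v)] (v : V)
    (e : ∀ w, w ≠ v → ι w ≃ ι' w)
    {O : Type} [Fintype O] (B : O → Matrix (ι' v) (ι v) ℂ) (hB : ∑ o, (B o)ᴴ * B o = 1)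
    {Θ : Matrix (∀ w, ι w) (Fin D) ℂ} {Θ' : O → Matrix (∀ w, ι' w) (Fin D) ℂ} {α : O → ℂ}
    (hα : ∑ o, ‖α o‖ ^ 2 = 1)
    (hΘ : ∀ o y l, ∑ a, B o (y v) a * Θ (insertLabel v e a y) l = α o * Θ' o y l)
    (hΘ' : ∀ o, α o ≠ 0 → IsRecoverable r (Θ' o)) : IsRecoverable r Θ := by
  refine .of_round v (fun o => localKraus v e (B o)) (by simpa only [localKraus_self] using hB)
    (fun o w hw => conjTranspose_localKraus_mul_self_of_ne hw e _) hα (fun o => ?_) hΘ'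
  ext y l
  rw [localOp_localKraus_mul_apply, hΘ]
  rfl

theorem IsRecoverable.of_equiv [∀ v, Fintype (ι' v)] (e : ∀ w, ι w ≃ ι' w)
    {Θ : Matrix (∀ w, ι' w) (Fin D) ℂ} (h : IsRecoverable r Θ) :
    IsRecoverable r (Θ.submatrix (Equiv.piCongrRight e) id) := by
  classical
  refine .of_kraus r (fun w _ => e w) (O := Unit)
    (fun _ => (1 : Matrix (ι r) (ι r) ℂ).submatrix (e r).symm id) ?_ (Θ' := fun _ => Θ) (α := 1)
    (by simp) (fun _ y l => ?_) fun _ _ => h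
  · simp [Matrix.conjTranspose_submatrix, Matrix.submatrix_mul_equiv]
  · have hinsert :
        Equiv.piCongrRight e (insertLabel r (fun w _ => e w) ((e r).symm (y r)) y) = y := by
      funext w
      by_cases hw : w = r
      · subst hw
        simp [insertLabel_self]
      · simp [insertLabel_of_ne hw]
    simp [Matrix.one_apply, hinsert]

theorem IsRecoverable.of_measurement [∀ v, DecidableEq (ι v)] [∀ v, Fintype (ι' v)] (v : V)
    [Unique (ι' v)]
    (e : ∀ w, w ≠ v → ι w ≃ ι' w) {O : Type} [Fintype O] (m : O → ι v → ℂ)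
    (hm : ∑ o, Matrix.vecMulVec (m o) (star (m o)) = 1)
    {Θ : Matrix (∀ w, ι w) (Fin D) ℂ} {Θ' : O → Matrix (∀ w, ι' w) (Fin D) ℂ} {α : O → ℂ}
    (hα : ∑ o, ‖α o‖ ^ 2 = 1)
    (hΘ : ∀ o y l, ∑ a, star (m o a) * Θ (insertLabel v e a y) l = α o * Θ' o y l)
    (hΘ' : ∀ o, α o ≠ 0 → IsRecoverable r (Θ' o)) : IsRecoverable r Θ := by
  refine .of_kraus v e (fun o => Matrix.of fun _ => star (m o)) ?_ hα hΘ hΘ'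
  rw [← hm]
  refine Finset.sum_congr rfl fun o _ => ?_
  ext a a'
  simp [Matrix.mul_apply, Matrix.vecMulVec_apply]

theorem exists_kraus_of_isometry {X κ : Type} [Fintype X] [DecidableEq X] [Fintype κ]
    [DecidableEq κ] [Nonempty κ] (W : Matrix X κ ℂ) (hW : Wᴴ * W = 1) :
    ∃ B : Option X → Matrix κ X ℂ, ∑ o, (B o)ᴴ * B o = 1 ∧ B none = Wᴴ ∧
      ∀ a, B (some a) * W = 0 := by
  obtain ⟨i⟩ := ‹Nonempty κ›
  set Q : Matrix X X ℂ := 1 - W * Wᴴ with hQ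
  have hQW : Q * W = 0 := by
    rw [hQ, Matrix.sub_mul, Matrix.mul_assoc, hW, Matrix.one_mul, Matrix.mul_one, sub_self]
  have hQH : Qᴴ = Q := by simp [hQ]
  have hQQ : Q * Q = Q := by
    conv_lhs => rw [hQ, Matrix.mul_sub, ← hQ, Matrix.mul_one, ← Matrix.mul_assoc, hQW]
    simp
  refine ⟨fun o => o.elim Wᴴ fun a => Matrix.single i a (1 : ℂ) * Q, ?_, rfl, fun a => ?_⟩
  · have hsome : ∀ a, (Matrix.single i a (1 : ℂ) * Q)ᴴ * (Matrix.single i a (1 : ℂ) * Q) =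
        Q * (Matrix.single a a (1 : ℂ) * Q) := by
      intro a
      rw [Matrix.conjTranspose_mul, hQH, Matrix.conjTranspose_single, star_one, Matrix.mul_assoc,
        ← Matrix.mul_assoc (Matrix.single a i 1), Matrix.single_mul_single_same, one_mul]
    simp only [Fintype.sum_option, Option.elim_none, Option.elim_some, hsome,
      Matrix.conjTranspose_conjTranspose]
    rw [← Matrix.mul_sum, ← Matrix.sum_mul, Matrix.sum_single_one, Matrix.one_mul, hQQ, hQ,
      add_sub_cancel]
  · exact (Matrix.mul_assoc _ _ _).trans (by rw [hQW, Matrix.mul_zero])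

theorem IsRecoverable.of_isometry (hD : 0 < D) (hι : ∀ w, w ≠ r → Unique (ι w))
    {Θ : Matrix (∀ w, ι w) (Fin D) ℂ} (hΘ : Θᴴ * Θ = 1) : IsRecoverable r Θ := by
  classical
  have := Fin.pos_iff_nonempty.1 hD
  have hsubsingleton : ∀ w, w ≠ r → Subsingleton (ι w) := fun w hw => (hι w hw).instSubsingleton
  let e : ∀ w, w ≠ r → ι w ≃ FinalSystem r D w := fun w hw =>
    have := hι w hw
    have : IsEmpty (w = r) := ⟨hw⟩
    Equiv.ofUnique _ _
  have hinsert : ∀ x y, insertLabel r e (x r) y = x := fun x y => funext fun w => by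
    by_cases hw : w = r
    · subst hw
      exact insertLabel_self ..
    · exact (hsubsingleton w hw).elim _ _
  let E : ι r ≃ ∀ w, ι w :=
    { toFun := fun a => insertLabel r e a fun _ _ => ⟨0, hD⟩
      invFun := fun x => x r
      left_inv := fun a => insertLabel_self ..
      right_inv := fun x => hinsert x _ }
  have hE : ∀ a y, insertLabel r e a y = E a := fun a y => by
    conv_lhs => rw [← E.left_inv a]
    exact hinsert (E a) y
  have := uniqueProp (rfl : r = r)
  let F : FinalSystem r D r ≃ Fin D := Equiv.funUnique (r = r) (Fin D)
  have hW : (Θ.submatrix E F)ᴴ * Θ.submatrix E F = 1 := by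
    rw [Matrix.conjTranspose_submatrix, Matrix.submatrix_mul_equiv, hΘ, Matrix.submatrix_one_equiv]
  obtain ⟨B, hB, hnone, hsome⟩ := exists_kraus_of_isometry (Θ.submatrix E F) hW
  refine .of_kraus r e B hB (α := fun o => if o = none then 1 else 0) (by simp)
    (fun o y l => ?_) fun _ _ => isRecoverable_final
  trans (B o * Θ.submatrix E F) (y r) (F.symm l)
  · simp only [hE]
    rfl
  cases o with
  | none =>
    rw [hnone, hW, if_pos rfl, one_mul]
    simp [F, Matrix.one_apply, funext_iff]
  | some a =>
    rw [hsome, if_neg (Option.some_ne_none a), zero_mul]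
    rfl

end Recoverable

namespace AscendingLabeling

variable {V : Type} [Fintype V] {T : SimpleGraph V} {r : V} (L : AscendingLabeling T r)
  {X : V → Type} {k : ℕ}

/-- The system of `v` when only `v_1, …, v_k` still hold their systems `X`; it is one-dimensional
for the other parties. -/
abbrev Stage (X : V → Type) (k : ℕ) (v : V) : Type := (L.label v : ℕ) < k → X v

/-- The joint label of `v_1, …, v_{k+1}` composed of those of `v_{k+1}` and of `v_1, …, v_k`, cast
as in `splitLast`. -/
def snoc (hk : k < Fintype.card V) (a : X (L.vertex k hk)) (y : ∀ w, L.Stage X k w) :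
    ∀ w, L.Stage X (k + 1) w :=
  fun w hw => if h : (L.label w : ℕ) < k then y w h else L.eq_vertex hk hw h ▸ a

theorem snoc_of_lt (hk : k < Fintype.card V) (a : X (L.vertex k hk)) (y : ∀ w, L.Stage X k w)
    {w : V} (hw : (L.label w : ℕ) < k + 1) (h : (L.label w : ℕ) < k) :
    L.snoc hk a y w hw = y w h := dif_pos h

theorem label_vertex_lt_succ (hk : k < Fintype.card V) : (L.label (L.vertex k hk) : ℕ) < k + 1 :=
  (L.label_vertex k hk).trans_lt k.lt_succ_self

theorem snoc_vertex (hk : k < Fintype.card V) (a : X (L.vertex k hk)) (y : ∀ w, L.Stage X k w) :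
    L.snoc hk a y (L.vertex k hk) (L.label_vertex_lt_succ hk) = a :=
  dif_neg (L.label_vertex k hk).not_lt

theorem map_snoc {Y : V → Type} (f : ∀ w, X w → Y w) (hk : k < Fintype.card V)
    (a : X (L.vertex k hk)) (y : ∀ w, L.Stage X k w) :
    L.snoc hk (f _ a) (fun w hw => f w (y w hw)) = fun w hw => f w (L.snoc hk a y w hw) := by
  funext w hw
  by_cases h : (L.label w : ℕ) < k
  · rw [snoc_of_lt _ _ _ _ hw h, snoc_of_lt _ _ _ _ hw h]
  · obtain rfl := L.eq_vertex hk hw h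
    rw [snoc_vertex, snoc_vertex]

/-- The joint labels of `v_1, …, v_{k+1}` are pairs of a label of `v_{k+1}` and one of
`v_1, …, v_k`. -/
def snocEquiv (X : V → Type) (hk : k < Fintype.card V) :
    X (L.vertex k hk) × (∀ w, L.Stage X k w) ≃ ∀ w, L.Stage X (k + 1) w where
  toFun x := L.snoc hk x.1 x.2
  invFun x := (x _ (L.label_vertex_lt_succ hk),
    fun w hw => x w (Nat.lt_succ_of_lt hw))
  left_inv x := Prod.ext (L.snoc_vertex hk x.1 x.2)
    (funext fun _ => funext fun hw => L.snoc_of_lt hk x.1 x.2 (Nat.lt_succ_of_lt hw) hw)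
  right_inv x := by
    funext w hw
    by_cases h : (L.label w : ℕ) < k
    · exact L.snoc_of_lt _ _ _ hw h
    · obtain rfl := L.eq_vertex hk hw h
      exact L.snoc_vertex ..

theorem ne_vertex_iff (hk : k < Fintype.card V) {w : V} :
    w ≠ L.vertex k hk ↔ ((L.label w : ℕ) < k + 1 ↔ (L.label w : ℕ) < k) := by
  rw [Ne, ← L.label.injective.eq_iff, Fin.ext_iff, L.label_vertex]
  omega

variable [DecidableEq V] [∀ v, Fintype (X v)] [∀ v, DecidableEq (X v)] {D : ℕ}

theorem isRecoverable_of_measurement (hk : k < Fintype.card V) {O : Type} [Fintype O]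
    (m : O → X (L.vertex k hk) → ℂ) (hm : ∑ o, Matrix.vecMulVec (m o) (star (m o)) = 1)
    {Θ : Matrix (∀ w, L.Stage X (k + 1) w) (Fin D) ℂ}
    {Θ' : O → Matrix (∀ w, L.Stage X k w) (Fin D) ℂ} {α : O → ℂ} (hα : ∑ o, ‖α o‖ ^ 2 = 1)
    (hΘ : ∀ o y l, ∑ a, star (m o a) * Θ (L.snoc hk a y) l = α o * Θ' o y l)
    (hΘ' : ∀ o, α o ≠ 0 → IsRecoverable r (Θ' o)) : IsRecoverable r Θ := by
  have := uniqueProp (L.label_vertex_lt_succ hk)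
  have : IsEmpty ((L.label (L.vertex k hk) : ℕ) < k) := ⟨(L.label_vertex k hk).not_lt⟩
  let e : ∀ w, w ≠ L.vertex k hk → L.Stage X (k + 1) w ≃ L.Stage X k w := fun w hw =>
    (Equiv.ofIff ((L.ne_vertex_iff hk).1 hw)).arrowCongr (Equiv.refl _)
  let F : L.Stage X (k + 1) (L.vertex k hk) ≃ X (L.vertex k hk) := Equiv.funUnique _ _
  have hinsert : ∀ a y, insertLabel (L.vertex k hk) e (F.symm a) y = L.snoc hk a y := by
    intro a y
    funext w hw
    by_cases h : (L.label w : ℕ) < k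
    · have hne : w ≠ L.vertex k hk := (L.ne_vertex_iff hk).2 (iff_of_true hw h)
      rw [insertLabel_of_ne hne, L.snoc_of_lt _ _ _ hw h]
      rfl
    · obtain rfl := L.eq_vertex hk hw h
      rw [insertLabel_self, snoc_vertex]
      rfl
  refine .of_measurement (L.vertex k hk) e (fun o => m o ∘ F) (sum_vecMulVec_comp_equiv F hm) hα
    (fun o y l => ?_) hΘ'
  rw [← hΘ, ← F.symm.sum_comp]
  simp only [hinsert, Function.comp_apply, Equiv.apply_symm_apply]

end AscendingLabeling

/-! ### Sequential merging along a rooted tree -/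

section Normalized

variable {X Y : Type} [Fintype X] [Fintype Y]

theorem norm_smul_normalized (ψ : X → Y → ℂ) :
    ((√(∑ x, ∑ y, ‖ψ x y‖ ^ 2) : ℝ) : ℂ) • normalized ψ = ψ := by
  ext x y
  rcases eq_or_ne (√(∑ x, ∑ y, ‖ψ x y‖ ^ 2)) 0 with h | h
  · have hsum : ∑ x, ∑ y, ‖ψ x y‖ ^ 2 = 0 := (Real.sqrt_eq_zero (by positivity)).1 h
    have hx := (Finset.sum_eq_zero_iff_of_nonneg fun x _ => by positivity).1 hsum x (by simp)
    have hy := (Finset.sum_eq_zero_iff_of_nonneg fun y _ => by positivity).1 hx y (by simp)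
    have hzero : ψ x y = 0 := norm_eq_zero.1 (pow_eq_zero_iff two_ne_zero |>.1 hy)
    simp [normalized, hzero]
  · have hc : ((√(∑ x, ∑ y, ‖ψ x y‖ ^ 2) : ℝ) : ℂ) ≠ 0 := Complex.ofReal_ne_zero.2 h
    simp only [Pi.smul_apply, normalized, smul_eq_mul]
    exact mul_div_cancel₀ _ hc

theorem gram_normalized {ψ : X → Y → ℂ} {G : Matrix X X ℂ} {t : ℝ} (hG : G.trace = 1)
    (h : gram ψ = (t : ℂ) • G) (hψ : ψ ≠ 0) :
    gram (normalized ψ) = G := by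
  set s := √(∑ x, ∑ y, ‖ψ x y‖ ^ 2) with hs
  have hsq : s ^ 2 = t := by
    have htrace := congrArg Matrix.trace h
    rw [trace_gram, Matrix.trace_smul, hG, smul_eq_mul, mul_one, Complex.ofReal_inj] at htrace
    rw [hs, Real.sq_sqrt (by positivity), htrace]
  have hsC : (s : ℂ) ≠ 0 := fun h₀ => hψ (by rw [← norm_smul_normalized ψ, h₀, zero_smul])
  have hscale : ((s : ℂ) ^ 2) • gram (normalized ψ) = ((s : ℂ) ^ 2) • G := by
    calc ((s : ℂ) ^ 2) • gram (normalized ψ) = gram ((s : ℂ) • normalized ψ) := by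
          rw [gram_smul, Complex.star_def, Complex.conj_ofReal, sq]
      _ = ((s : ℂ) ^ 2) • G := by
          rw [norm_smul_normalized, h, ← hsq, Complex.ofReal_pow]
  exact smul_right_injective _ (pow_ne_zero 2 hsC) hscale

end Normalized

theorem exists_eq_of_bijective {I J : Type} {Z : J → Type} {σ : I → J}
    (hσ : Function.Bijective σ) (g : ∀ i, Z (σ i)) : ∃ f : ∀ j, Z j, ∀ i, f (σ i) = g i :=
  ⟨Equiv.piCongrLeft Z (Equiv.ofBijective σ hσ) g,
    fun i => Equiv.piCongrLeft_apply_apply Z (Equiv.ofBijective σ hσ) g i⟩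

section ParentEdge

variable {V : Type} {T : SimpleGraph V} (hT : T.IsTree) {r : V}

theorem adj_parent {c : V} (hc : c ≠ r) : T.Adj (parent hT r c) c :=
  ((hT.existsUnique_path c r).choose.adj_snd (SimpleGraph.Walk.not_nil_of_ne hc)).symm

/-- The edge `{p(c), c}` between a vertex `c` other than the root and its parent. -/
def parentEdge (c : {c : V // c ≠ r}) : T.edgeSet :=
  ⟨s(parent hT r c, c), adj_parent hT c.2⟩

variable [Fintype V]

theorem parentEdge_bijective (L : AscendingLabeling T r) :
    Function.Bijective (parentEdge (r := r) hT) := by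
  classical
  rw [Fintype.bijective_iff_injective_and_card]
  constructor
  · intro c c' h
    rcases Sym2.eq_iff.1 (congrArg Subtype.val h) with h' | h'
    · exact Subtype.ext h'.2
    · have hlt := L.parent_lt hT c.2
      have hlt' := L.parent_lt hT c'.2
      rw [h'.1] at hlt
      rw [← h'.2] at hlt'
      exact absurd hlt hlt'.asymm
  · have hcard := hT.card_edgeFinset
    rw [SimpleGraph.edgeFinset_card] at hcard
    rw [Fintype.card_subtype_compl, Fintype.card_subtype_eq]
    omega

theorem AscendingLabeling.ne_root (L : AscendingLabeling T r) {c : V}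
    (h : 0 < (L.label c : ℕ)) : c ≠ r := by
  rintro rfl
  exact h.ne' L.label_root

theorem AscendingLabeling.label_parent_lt (L : AscendingLabeling T r) {c : V} (hc : c ≠ r) :
    (L.label (parent hT r c) : ℕ) < L.label c := L.parent_lt hT hc

end ParentEdge

section PartySystem

variable {V : Type} [Fintype V] {T : SimpleGraph V} (hT : T.IsTree) (r : V)
  (M : Sym2 V → ℕ) (ι : V → Type)

/-- What the party `v` holds at the beginning, with the edges at `v` replaced by their lower ends:
its part of the physical system, its half of `Φ_M⁺` for each child `c`, and, unless `v` is the
root, its half of the one shared with its parent. -/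
abbrev PartySystem (v : V) : Type :=
  ι v × (∀ c : V, parent hT r c = v → c ≠ r → Fin (M s(parent hT r c, c))) ×
    (v ≠ r → Fin (M s(parent hT r v, v)))

/-- The identification of the systems `InitialSystem` and `PartySystem` of the party `v`. -/
def initialToParty (v : V) (x : InitialSystem T M ι v) : PartySystem hT r M ι v :=
  (x.1, fun c hc hr => x.2 (parentEdge hT ⟨c, hr⟩) (hc ▸ Sym2.mem_mk_left _ _),
    fun hr => x.2 (parentEdge hT ⟨v, hr⟩) (Sym2.mem_mk_right _ _))

variable {r}

theorem initialToParty_bijective (L : AscendingLabeling T r) (v : V) :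
    Function.Bijective (initialToParty hT r M ι v) := by
  classical
  have hσ := parentEdge_bijective hT L
  have hmem : ∀ c : {c // c ≠ r}, v ∈ (parentEdge hT c).1 → parent hT r c = v ∨ c.1 = v :=
    fun c hv => (Sym2.mem_iff.1 hv).imp Eq.symm Eq.symm
  constructor
  · intro x x' h
    refine Prod.ext (congrArg (·.1) h) (funext fun e => funext fun hv => ?_)
    obtain ⟨c, rfl⟩ := hσ.2 e
    rcases hmem c hv with hc | hc
    · exact congrFun (congrFun (congrFun (congrArg (·.2.1) h) c.1) hc) c.2
    · subst hc
      exact congrFun (congrArg (·.2.2) h) c.2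
  · rintro ⟨a, y, z⟩
    obtain ⟨x, hx⟩ := exists_eq_of_bijective
      (Z := fun e : T.edgeSet => v ∈ e.1 → Fin (M e.1)) hσ fun c hv =>
        if hc : parent hT r c = v then y c.1 hc c.2
        else
          have hcv : c.1 = v := (hmem c hv).resolve_left hc
          (z (hcv ▸ c.2)).cast (by rw [← hcv]; rfl)
    refine ⟨(a, x), Prod.ext rfl (Prod.ext ?_ ?_)⟩
    · funext c hc hr
      exact (congrFun (hx ⟨c, hr⟩) _).trans (dif_pos hc)
    · funext hr
      exact (congrFun (hx ⟨v, hr⟩) _).trans (dif_neg (adj_parent hT hr).ne)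

end PartySystem

namespace AscendingLabeling

variable {V : Type} [Fintype V] {T : SimpleGraph V} (hT : T.IsTree) {r : V}
  (L : AscendingLabeling T r) {k : ℕ}

theorem label_pos (hT : T.IsTree) {c : V} (hc : c ≠ r) : 0 < (L.label c : ℕ) :=
  Nat.zero_lt_of_lt (L.label_parent_lt hT hc)

theorem vertex_succ_ne_root (hk : k + 1 < Fintype.card V) : L.vertex (k + 1) hk ≠ r :=
  L.ne_root ((L.label_vertex _ hk).symm ▸ k.succ_pos)

theorem lt_label_of_parent_eq_vertex (hk : k < Fintype.card V) {c : V} (hc : c ≠ r)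
    (h : parent hT r c = L.vertex k hk) : k < L.label c := by
  have hlt := L.label_parent_lt hT hc
  rwa [h, L.label_vertex] at hlt

end AscendingLabeling

section StageEncoding

variable {V : Type} [Fintype V] [DecidableEq V] {T : SimpleGraph V} (hT : T.IsTree) {r : V}
  (L : AscendingLabeling T r) (M : Sym2 V → ℕ) {ι : V → Type} {D k : ℕ}

/-- The part of the system of the party `w` that belongs to `HeldSystem` when `v_1, …, v_k`
remain: the halves shared with the parent and with the children among `v_1, …, v_k` are left
out, since their resource states are still to be used. -/
def partyToHeld (hk : 0 < k) (w : V) (x : PartySystem hT r M ι w) :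
    HeldSystem hT L M ι k w :=
  (x.1, fun c hc hle => x.2.1 c hc (L.ne_root (hk.trans_le hle)))

/-- The joint system of `v_1` alone is all that this party had at the beginning. -/
def rootEquiv : (∀ w, L.Stage (PartySystem hT r M ι) 1 w) ≃ JointSystem hT L M ι 1 where
  toFun x w hw := partyToHeld hT L M Nat.one_pos w (x w hw)
  invFun x w hw := ((x w hw).1, fun c hc hr => (x w hw).2 c hc (L.label_pos hT hr),
    fun hr => absurd (L.label_pos hT hr) (Nat.lt_one_iff.1 hw).not_gt)
  left_inv _ := funext fun _ => funext fun hw => Prod.ext rfl <| Prod.ext rfl <| funext fun hr =>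
    absurd (L.label_pos hT hr) (Nat.lt_one_iff.1 hw).not_gt
  right_inv _ := rfl

/-- All that `v_{k+2}` had at the beginning is its system during its merging together with its
half of the resource state shared with its parent. -/
def lastEquiv (ι : V → Type) (hk : k + 1 < Fintype.card V) :
    PartySystem hT r M ι (L.vertex (k + 1) hk) ≃
      HeldSystem hT L M ι (k + 2) (L.vertex (k + 1) hk) ×
        Fin (M s(parent hT r (L.vertex (k + 1) hk), L.vertex (k + 1) hk)) where
  toFun x := (partyToHeld hT L M (Nat.succ_pos _) _ x, x.2.2 (L.vertex_succ_ne_root hk))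
  invFun x := (x.1.1, fun c hc hr => x.1.2 c hc (L.lt_label_of_parent_eq_vertex hT hk hr hc),
    fun _ => x.2)
  left_inv _ := rfl
  right_inv _ := rfl

/-- The identification of basis labels that underlies `absorb`. -/
def absorbEquiv (ι : V → Type) (hk : k + 1 < Fintype.card V) :
    JointSystem hT L M ι (k + 1) ≃ RestSystem hT L M ι (k + 1) ×
      Fin (M s(parent hT r (L.vertex (k + 1) hk), L.vertex (k + 1) hk)) where
  toFun x := (fun w hw => ((x w hw).1, fun c hc hle => (x w hw).2 c hc (Nat.le_of_succ_le hle)),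
    (x _ (L.label_parent_vertex hT k hk)).2 (L.vertex (k + 1) hk) rfl
      (L.label_vertex (k + 1) hk).ge)
  invFun x w hw := ((x.1 w hw).1, fun c hc hle =>
    if h : k + 2 ≤ (L.label c : ℕ) then (x.1 w hw).2 c hc h
    else L.eq_vertex hk (not_le.1 h) hle.not_gt ▸ x.2)
  left_inv x := by
    funext w hw
    refine Prod.ext rfl (funext fun c => funext fun hc => funext fun hle => ?_)
    by_cases h : k + 2 ≤ (L.label c : ℕ)
    · exact dif_pos h
    · obtain rfl := L.eq_vertex hk (not_le.1 h) hle.not_gt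
      subst hc
      exact dif_neg h
  right_inv x := by
    refine Prod.ext ?_ (dif_neg (L.label_vertex_lt_succ hk).not_ge)
    funext w hw
    exact Prod.ext rfl (funext fun c => funext fun hc => funext fun hle => dif_pos hle)

/-- The factor contributed to the joint state of `v_1, …, v_k` by the edge above `c`: the amplitude
of its resource state as long as `c` is among these parties, and `1` afterwards. -/
def edgeAmp (k : ℕ) (x : ∀ w, L.Stage (PartySystem hT r M ι) k w) (c : {c : V // c ≠ r}) : ℂ :=
  if h : (L.label c.1 : ℕ) < k then
    maxEnt _ ((x c.1 h).2.2 c.2)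
      ((x (parent hT r c) ((L.label_parent_lt hT c.2).trans h)).2.1 c rfl c.2)
  else 1

/-- The encoding of `ℂ^D` that the parties `v_1, …, v_k` hold when `ψ` is the corresponding state
with a reference: `|l⟩` goes to `√D (⟨l|^R ⊗ 1) ψ`, tensored with the resource states that are
still to be used. -/
def stageEncoding (hk : 0 < k) (ψ : Fin D → JointSystem hT L M ι k → ℂ) :
    Matrix (∀ w, L.Stage (PartySystem hT r M ι) k w) (Fin D) ℂ :=
  Matrix.of fun x l => (√D : ℝ) * ψ l (fun w hw => partyToHeld hT L M hk w (x w hw)) *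
    ∏ c, edgeAmp hT L M k x c

theorem stageEncoding_smul (hk : 0 < k) (c : ℂ) (ψ : Fin D → JointSystem hT L M ι k → ℂ) :
    stageEncoding hT L M hk (c • ψ) = c • stageEncoding hT L M hk ψ := by
  ext x l
  simp only [stageEncoding, Matrix.of_apply, Matrix.smul_apply, Pi.smul_apply, smul_eq_mul]
  ring

theorem prod_edgeAmp_snoc (hk : k + 1 < Fintype.card V)
    (a : PartySystem hT r M ι (L.vertex (k + 1) hk))
    (y : ∀ w, L.Stage (PartySystem hT r M ι) (k + 1) w) :
    ∏ c, edgeAmp hT L M (k + 2) (L.snoc hk a y) c =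
      maxEnt _ (lastEquiv hT L M ι hk a).2
        (absorbEquiv hT L M ι hk
          fun w hw => partyToHeld hT L M k.succ_pos w (y w hw)).2 *
      ∏ c, edgeAmp hT L M (k + 1) y c := by
  let v : {c : V // c ≠ r} := ⟨L.vertex (k + 1) hk, L.vertex_succ_ne_root hk⟩
  set β := maxEnt _ (lastEquiv hT L M ι hk a).2
    (absorbEquiv hT L M ι hk fun w hw => partyToHeld hT L M k.succ_pos w (y w hw)).2
  have hstep : ∀ c, edgeAmp hT L M (k + 2) (L.snoc hk a y) c =
      (if c = v then β else 1) * edgeAmp hT L M (k + 1) y c := by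
    intro c
    by_cases hc : (L.label c.1 : ℕ) < k + 1
    · have hcv : c ≠ v := by
        rintro rfl
        exact (L.label_vertex (k + 1) hk).not_lt hc
      rw [if_neg hcv, one_mul, edgeAmp, dif_pos (Nat.lt_succ_of_lt hc), edgeAmp, dif_pos hc,
        L.snoc_of_lt _ _ _ _ hc, L.snoc_of_lt _ _ _ _ ((L.label_parent_lt hT c.2).trans hc)]
    · rw [edgeAmp.eq_def _ _ _ (k + 1), dif_neg hc, mul_one]
      split_ifs with hcv
      · subst hcv
        rw [edgeAmp, dif_pos (L.label_vertex_lt_succ hk),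
          L.snoc_of_lt _ _ _ _ (L.label_parent_vertex hT k hk)]
        exact congrArg (fun z => maxEnt _ (z.2.2 v.2) _) (L.snoc_vertex hk a y)
      · refine dif_neg fun h => hcv (Subtype.ext ?_)
        exact (L.eq_vertex hk h hc).symm
  rw [Finset.prod_congr rfl fun c _ => hstep c, Finset.prod_mul_distrib, Fintype.prod_ite_eq']

variable [∀ v, Fintype (ι v)]

theorem sum_star_mul_stageEncoding_snoc (hk : k + 1 < Fintype.card V)
    (ψ : Fin D → JointSystem hT L M ι (k + 2) → ℂ)
    (m : HeldSystem hT L M ι (k + 2) (L.vertex (k + 1) hk) ×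
      Fin (M s(parent hT r (L.vertex (k + 1) hk), L.vertex (k + 1) hk)) → ℂ)
    (y : ∀ w, L.Stage (PartySystem hT r M ι) (k + 1) w) (l : Fin D) :
    ∑ a, star (m (lastEquiv hT L M ι hk a)) *
        stageEncoding hT L M (Nat.succ_pos _) ψ (L.snoc hk a y) l =
      stageEncoding hT L M k.succ_pos
        (absorb hT L M k hk (measured (splitLast hT L M (k + 1) hk ψ) m)) y l := by
  set z := absorbEquiv hT L M ι hk fun w hw => partyToHeld hT L M k.succ_pos w (y w hw)
  have hterm : ∀ a, stageEncoding hT L M (Nat.succ_pos _) ψ (L.snoc hk a y) l =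
      (√D : ℝ) * splitLast hT L M (k + 1) hk ψ l (lastEquiv hT L M ι hk a).1 z.1 *
        (maxEnt _ (lastEquiv hT L M ι hk a).2 z.2 * ∏ c, edgeAmp hT L M (k + 1) y c) := by
    intro a
    rw [stageEncoding, Matrix.of_apply, prod_edgeAmp_snoc,
      ← L.map_snoc (fun w => partyToHeld hT L M (k + 1).succ_pos w)]
    rfl
  have habsorb : absorb hT L M k hk (measured (splitLast hT L M (k + 1) hk ψ) m) l
      (fun w hw => partyToHeld hT L M k.succ_pos w (y w hw)) =
        ∑ a, star (m a) * (splitLast hT L M (k + 1) hk ψ l a.1 z.1 * maxEnt _ a.2 z.2) :=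
    (Fintype.sum_prod_type' _).symm
  simp only [hterm]
  rw [stageEncoding, Matrix.of_apply, habsorb, Finset.mul_sum, Finset.sum_mul,
    ← (lastEquiv hT L M ι hk).sum_comp]
  exact Finset.sum_congr rfl fun a _ => by ring

end StageEncoding

section Merging

variable {V : Type} [Fintype V] [DecidableEq V] {T : SimpleGraph V} (hT : T.IsTree) {r : V}
  (L : AscendingLabeling T r) {M : Sym2 V → ℕ} {ι : V → Type} [∀ v, Fintype (ι v)] {D k : ℕ}

theorem gram_splitLast (hk : k < Fintype.card V) (ψ : Fin D → JointSystem hT L M ι (k + 1) → ℂ) :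
    gram (fun l => Function.uncurry (splitLast hT L M k hk ψ l)) = gram ψ :=
  gram_comp_equiv (L.snocEquiv (HeldSystem hT L M ι (k + 1)) hk) ψ

theorem gram_absorb (hk : k + 1 < Fintype.card V)
    (ψ : Fin D → RestSystem hT L M ι (k + 1) ×
      Fin (M s(parent hT r (L.vertex (k + 1) hk), L.vertex (k + 1) hk)) → ℂ) :
    gram (absorb hT L M k hk ψ) = gram ψ :=
  gram_comp_equiv (absorbEquiv hT L M ι hk) ψ

theorem trace_inv_smul_one (hD : 0 < D) :
    ((D : ℂ)⁻¹ • (1 : Matrix (Fin D) (Fin D) ℂ)).trace = 1 := by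
  rw [Matrix.trace_smul, Matrix.trace_one, Fintype.card_fin, smul_eq_mul,
    inv_mul_cancel₀ (Nat.cast_ne_zero.2 hD.ne')]

theorem isRecoverable_stageEncoding_one (hD : 0 < D) {ψ : Fin D → JointSystem hT L M ι 1 → ℂ}
    (hψ : gram ψ = (D : ℂ)⁻¹ • 1) : IsRecoverable r (stageEncoding hT L M Nat.one_pos ψ) := by
  classical
  have hdim : ∀ w, w ≠ r → Unique (L.Stage (PartySystem hT r M ι) 1 w) := fun w hw =>
    have : IsEmpty ((L.label w : ℕ) < 1) := ⟨not_lt.2 (L.label_pos hT hw)⟩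
    inferInstance
  refine .of_isometry hD hdim ?_
  have happly : ∀ x l, stageEncoding hT L M Nat.one_pos ψ x l =
      (((√D : ℝ) : ℂ) • ψ) l (rootEquiv hT L M x) := fun x l => by
    have hprod : ∏ c, edgeAmp hT L M 1 x c = 1 := Finset.prod_eq_one fun c _ =>
      dif_neg (not_lt.2 (L.label_pos hT c.2))
    rw [stageEncoding, Matrix.of_apply, hprod, mul_one]
    rfl
  calc (stageEncoding hT L M Nat.one_pos ψ)ᴴ * stageEncoding hT L M Nat.one_pos ψ
      = gram fun l x => (((√D : ℝ) : ℂ) • ψ) l (rootEquiv hT L M x) := by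
        ext l l'
        simp only [Matrix.mul_apply, Matrix.conjTranspose_apply, happly, gram_apply]
    _ = (D : ℂ) • gram ψ := by
        rw [gram_comp_equiv, gram_smul, Complex.star_def, Complex.conj_ofReal,
          ← Complex.ofReal_mul, Real.mul_self_sqrt D.cast_nonneg, Complex.ofReal_natCast]
    _ = 1 := by rw [hψ, smul_inv_smul₀ (Nat.cast_ne_zero.2 hD.ne')]

section

variable {L} {hk : k + 1 < Fintype.card V} {ψ : Fin D → JointSystem hT L M ι (k + 2) → ℂ} {n : ℕ}
  {m : Fin n → HeldSystem hT L M ι (k + 2) (L.vertex (k + 1) hk) ×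
    Fin (M s(parent hT r (L.vertex (k + 1) hk), L.vertex (k + 1) hk)) → ℂ}

theorem IsExactMerging.gram_normalized_absorb_measured
    (hm : IsExactMerging (splitLast hT L M (k + 1) hk ψ) m) (hψ : (gram ψ).trace = 1) {o : Fin n}
    (ho : absorb hT L M k hk (measured (splitLast hT L M (k + 1) hk ψ) (m o)) ≠ 0) :
    gram (normalized (absorb hT L M k hk (measured (splitLast hT L M (k + 1) hk ψ) (m o)))) =
      gram ψ := by
  obtain ⟨t, -, ht⟩ := hm.exists_gram_measured o
  rw [gram_splitLast, ← gram_absorb] at ht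
  exact gram_normalized hψ ht ho

theorem IsExactMerging.sum_norm_sq_absorb_measured
    (hm : IsExactMerging (splitLast hT L M (k + 1) hk ψ) m)
    (hK : 0 < M s(parent hT r (L.vertex (k + 1) hk), L.vertex (k + 1) hk))
    (hψ : (gram ψ).trace = 1) :
    ∑ o, ∑ l, ∑ x,
      ‖absorb hT L M k hk (measured (splitLast hT L M (k + 1) hk ψ) (m o)) l x‖ ^ 2 = 1 := by
  classical
  have hgram : ∑ o, gram (absorb hT L M k hk (measured (splitLast hT L M (k + 1) hk ψ) (m o))) =
      gram ψ := by
    simp only [gram_absorb]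
    rw [sum_gram_measured hK _ (by convert hm.1), gram_splitLast]
  rw [← hgram, Matrix.trace_sum] at hψ
  simp only [trace_gram] at hψ
  exact_mod_cast hψ

theorem IsExactMerging.isRecoverable_stageEncoding
    (hm : IsExactMerging (splitLast hT L M (k + 1) hk ψ) m)
    (hK : 0 < M s(parent hT r (L.vertex (k + 1) hk), L.vertex (k + 1) hk))
    (hψ : (gram ψ).trace = 1)
    (hnext : ∀ o, absorb hT L M k hk (measured (splitLast hT L M (k + 1) hk ψ) (m o)) ≠ 0 →
      IsRecoverable r (stageEncoding hT L M k.succ_pos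
        (normalized (absorb hT L M k hk (measured (splitLast hT L M (k + 1) hk ψ) (m o)))))) :
    IsRecoverable r (stageEncoding hT L M (k + 1).succ_pos ψ) := by
  classical
  set χ : Fin n → Fin D → JointSystem hT L M ι (k + 1) → ℂ := fun o =>
    absorb hT L M k hk (measured (splitLast hT L M (k + 1) hk ψ) (m o))
  set α : Fin n → ℂ := fun o => ((√(∑ l, ∑ x, ‖χ o l x‖ ^ 2) : ℝ) : ℂ) with hα
  have hα_sum : ∑ o, ‖α o‖ ^ 2 = 1 := by
    rw [← hm.sum_norm_sq_absorb_measured hT hK hψ]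
    refine Finset.sum_congr rfl fun o _ => ?_
    rw [hα, Complex.norm_real, Real.norm_eq_abs, sq_abs, Real.sq_sqrt (by positivity)]
  have hα_smul : ∀ o, χ o = α o • normalized (χ o) := fun o => (norm_smul_normalized (χ o)).symm
  refine L.isRecoverable_of_measurement hk (fun o => m o ∘ lastEquiv hT L M ι hk)
    (sum_vecMulVec_comp_equiv _ (by convert hm.1)) hα_sum
    (Θ' := fun o => stageEncoding hT L M k.succ_pos (normalized (χ o))) (fun o y l => ?_)
    fun o ho => hnext o fun h₀ => ho ?_
  · calc ∑ a, star (m o (lastEquiv hT L M ι hk a)) *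
          stageEncoding hT L M (k + 1).succ_pos ψ (L.snoc hk a y) l
        = stageEncoding hT L M k.succ_pos (χ o) y l :=
          sum_star_mul_stageEncoding_snoc hT L M hk ψ (m o) y l
      _ = α o * stageEncoding hT L M k.succ_pos (normalized (χ o)) y l := by
          conv_lhs => rw [hα_smul, stageEncoding_smul]
          rfl
  · change χ o = 0 at h₀
    simp [hα, h₀]

end

theorem isRecoverable_stageEncoding (hM : ∀ e ∈ T.edgeSet, 0 < M e) (hD : 0 < D) :
    ∀ {k : ℕ} (hk₀ : 0 < k) (hk : k ≤ Fintype.card V) {ψ : Fin D → JointSystem hT L M ι k → ℂ},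
      gram ψ = (D : ℂ)⁻¹ • 1 → MergingCostBound hT L M k hk ψ →
      IsRecoverable r (stageEncoding hT L M hk₀ ψ)
  | 1, _, _, _, hψ, _ => isRecoverable_stageEncoding_one hT L hD hψ
  | k + 2, _, hk, ψ, hψ, ⟨⟨δ, hδ⟩, n, m, hm, hnext⟩ => by
    have hK : 0 < M s(parent hT r (L.vertex (k + 1) hk), L.vertex (k + 1) hk) :=
      hM _ (adj_parent hT (L.vertex_succ_ne_root hk))
    have htrace : (gram ψ).trace = 1 := hψ ▸ trace_inv_smul_one hD
    have hmerge := hm (δ.exists_isExactMerging hK hδ)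
    refine hmerge.isRecoverable_stageEncoding hT hK htrace fun o ho => ?_
    refine isRecoverable_stageEncoding hM hD k.succ_pos _
      ((hmerge.gram_normalized_absorb_measured hT htrace ho).trans hψ) (hnext o fun h₀ => ho ?_)
    rw [h₀]
    rfl

end Merging

section Initial

variable {V : Type} [Fintype V] [DecidableEq V] {T : SimpleGraph V} (hT : T.IsTree) {r : V}
  (L : AscendingLabeling T r) (M : Sym2 V → ℕ) {ι : V → Type} {D : ℕ}

/-- A joint label of all parties consists of their labels alone: all resource states are still to
be used. -/
def jointEquiv : JointSystem hT L M ι (Fintype.card V) ≃ ∀ v, ι v where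
  toFun x v := (x v (L.label v).isLt).1
  invFun y v _ := (y v, fun c _ hle => absurd (L.label c).isLt hle.not_gt)
  left_inv _ := funext fun _ => funext fun _ => Prod.ext rfl <| funext fun c => funext fun _ =>
    funext fun hle => absurd (L.label c).isLt hle.not_gt
  right_inv _ := rfl

theorem gram_referenceState [∀ v, Fintype (ι v)] {U : Matrix (∀ v, ι v) (Fin D) ℂ}
    (hU : Uᴴ * U = 1) : gram (referenceState hT L M U) = (D : ℂ)⁻¹ • 1 := by
  have hsq : ((1 / √D : ℝ) : ℂ) * ((1 / √D : ℝ) : ℂ) = (D : ℂ)⁻¹ := by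
    rw [← Complex.ofReal_mul, div_mul_div_comm, Real.mul_self_sqrt D.cast_nonneg, one_mul,
      one_div, Complex.ofReal_inv, Complex.ofReal_natCast]
  have hgram : gram (fun l y => U y l) = 1 := by
    ext l l'
    rw [gram_apply, ← hU]
    rfl
  calc gram (referenceState hT L M U)
      = gram (((1 / √D : ℝ) : ℂ) • fun l y => U y l) :=
        gram_comp_equiv (jointEquiv hT L M) (((1 / √D : ℝ) : ℂ) • fun l y => U y l)
    _ = (D : ℂ)⁻¹ • 1 := by
        rw [gram_smul, Complex.star_def, Complex.conj_ofReal, hsq, hgram]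

/-- The identification of what `v` holds at the beginning with its system at the stage at which
all parties remain. -/
def initialEquiv (ι : V → Type) (v : V) :
    InitialSystem T M ι v ≃ L.Stage (PartySystem hT r M ι) (Fintype.card V) v :=
  have := uniqueProp (L.label v).isLt
  (Equiv.ofBijective _ (initialToParty_bijective hT M ι L v)).trans (Equiv.funUnique _ _).symm

theorem resourceAmp_eq_prod_edgeAmp [DecidableRel T.Adj] (x : ∀ v, InitialSystem T M ι v) :
    resourceAmp T M x =
      ∏ c, edgeAmp hT L M (Fintype.card V) (fun v => initialEquiv hT L M ι v (x v)) c := by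
  classical
  rw [resourceAmp, ← (parentEdge_bijective hT L).prod_comp]
  refine Finset.prod_congr rfl fun c _ => ?_
  rw [edgeAmp, dif_pos (L.label c.1).isLt, maxEnt]
  refine if_congr ⟨fun h => h _ _ _ _, fun h v w hv hw => ?_⟩ rfl rfl
  rcases Sym2.mem_iff.1 hv with rfl | rfl <;> rcases Sym2.mem_iff.1 hw with hw' | hw'
  all_goals subst hw'
  · rfl
  · exact h.symm
  · exact h
  · rfl

/-- The encoding `ρ ↦ U ρ U† ⊗ ⨂ e, |Φ_{M e}⁺⟩⟨Φ_{M e}⁺|` that produces `initialState`. -/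
def initialEncoding (T : SimpleGraph V) [DecidableRel T.Adj] (U : Matrix (∀ v, ι v) (Fin D) ℂ) :
    Matrix (∀ v, InitialSystem T M ι v) (Fin D) ℂ :=
  Matrix.of fun x l => U (fun v => (x v).1) l * resourceAmp T M x

theorem initialState_eq_initialEncoding_mul (T : SimpleGraph V) [DecidableRel T.Adj]
    (U : Matrix (∀ v, ι v) (Fin D) ℂ) (ρ : Matrix (Fin D) (Fin D) ℂ) :
    initialState T M U ρ = initialEncoding M T U * ρ * (initialEncoding M T U)ᴴ := by
  ext x y
  simp only [initialState, initialEncoding, Matrix.mul_apply, Matrix.conjTranspose_apply,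
    Matrix.of_apply, star_mul', Finset.sum_mul]
  exact Finset.sum_congr rfl fun _ _ => Finset.sum_congr rfl fun _ _ => by ring

theorem stageEncoding_referenceState [DecidableRel T.Adj] (hD : 0 < D) (hV : 0 < Fintype.card V)
    (U : Matrix (∀ v, ι v) (Fin D) ℂ) :
    (stageEncoding hT L M hV (referenceState hT L M U)).submatrix
      (Equiv.piCongrRight (initialEquiv hT L M ι)) id = initialEncoding M T U := by
  have hD' : ((√D : ℝ) : ℂ) ≠ 0 :=
    Complex.ofReal_ne_zero.2 (Real.sqrt_ne_zero'.2 (Nat.cast_pos.2 hD))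
  ext x l
  rw [initialEncoding, Matrix.of_apply, resourceAmp_eq_prod_edgeAmp hT L, Matrix.submatrix_apply,
    stageEncoding, Matrix.of_apply, referenceState, one_div, Complex.ofReal_inv,
    mul_inv_cancel_left₀ hD']
  rfl

end Initial

end

theorem theorem2 {V : Type} [Fintype V] [DecidableEq V]
    (T : SimpleGraph V) [DecidableRel T.Adj] (hT : T.IsTree) (r : V)
    (ι : V → Type) [∀ v, Fintype (ι v)]
    (D : ℕ) (hD : 0 < D)
    (U : Matrix (∀ v, ι v) (Fin D) ℂ) (hU : Uᴴ * U = 1)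
    (M : Sym2 V → ℕ) (hM : ∀ e ∈ T.edgeSet, 0 < M e)
    (hcost : ∃ L : AscendingLabeling T r,
      MergingCostBound hT L M (Fintype.card V) le_rfl (referenceState hT L M U)) :
    ConcentratingAchievable T r U M := by
  classical
  obtain ⟨L, hL⟩ := hcost
  have hV : 0 < Fintype.card V := Fintype.card_pos_iff.2 ⟨r⟩
  have hstage : IsRecoverable r (stageEncoding hT L M hV (referenceState hT L M U)) :=
    isRecoverable_stageEncoding hT L hM hD hV le_rfl (gram_referenceState hT L M hU) hL
  obtain ⟨C, hC, hrec⟩ := hstage.of_equiv (initialEquiv hT L M ι)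
  refine ⟨C, hC, fun ρ _ _ => ?_⟩
  rw [initialState_eq_initialEncoding_mul, ← stageEncoding_referenceState hT L M hD hV, hrec]
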